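/- A \emph{generalized pattern} is a word in the alphabet $1,2,3,\dots$ in which two adjacent letters may or may not be separated by a dash. An \emph{occurrence} of a generalized pattern $\tau$ with $k$ letters in a permutation $\pi=\pi_1\cdots\pi_n\in S_n$ is a choice of positions $i_1<\cdots<i_k$ such that $(\pi_{i_1},\dots,\pi_{i_k})$ is order-isomorphic to the word of $\tau$ and such that $i_{j+1}=i_j+1$ whenever the $j$-th and $(j+1)$-st letters of $\tau$ are not separated by a dash. For a generalized pattern $\tau$ let $\Phi_\tau(x)=\sum_{n\ge0}a_nx^n$, where $a_n$ is the number of permutations in $S_n$ that have exactly one occurrence of $1\text{-}3\text{-}2$ and exactly one occurrence of $\tau$. Let $U_p$ be the Chebyshev polynomials of the second kind, $U_p(\cos\theta)=\sin((p+1)\theta)/\sin\theta$, and put $t=\frac{1}{2\sqrt x}$. The following identities hold as identities of formal series in $\sqrt x$ (with finitely many negative exponents allowed). (a) For every $k\ge2$, $$\Phi_{12\text{-}3\text{-}\cdots\text{-}k}(x)=\frac{1}{U_2(t)\,U_k^2(t)}\left[1+\sum_{i=2}^{k-1}\frac{2\sqrt x}{U_i(t)\,U_{i+1}(t)}\left(\sum_{j=1}^{i}U_j^2(t)-1\right)\right].$$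 (b) For every $k\ge3$, $$\Phi_{21\text{-}3\text{-}\cdots\text{-}k}(x)=\frac{1}{4t^3\,U_k^2(t)}\left[\frac{U_2^2(t)}{U_3(t)}+\sum_{i=3}^{k-1}\frac{1}{U_i(t)\,U_{i+1}(t)}\left(\sum_{j=1}^{i}U_j^2(t)-2\right)\right].$$ -/

import Mathlib

/-- A generalized permutation pattern with `k` letters: a word in the alphabet `1, 2, 3, …`
in which two adjacent letters may or may not be separated by a dash. `glued i` says that there is
no dash between the letter at position `i` and the next letter (it carries no information when
`i` is the last position). -/
structure GeneralizedPattern (k : ℕ) where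
  /-- the letters, from left to right -/
  letter : Fin k → ℕ
  /-- absence of a dash directly after the given position -/
  glued : Fin k → Prop

namespace GeneralizedPattern

/-- The positions `e 0 < e 1 < ⋯ < e (k - 1)` form an occurrence of `τ` in the permutation `π`:
the letters of `π` at these positions are order-isomorphic to `τ`, and letters of `τ` that are not
separated by a dash correspond to adjacent letters of `π`. -/
def IsOccurrence {k n : ℕ} (τ : GeneralizedPattern k) (π : Equiv.Perm (Fin n))
    (e : Fin k ↪o Fin n) : Prop :=
  (∀ i j : Fin k, π (e i) < π (e j) ↔ τ.letter i < τ.letter j) ∧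
    ∀ i j : Fin k, τ.glued i → (j : ℕ) = (i : ℕ) + 1 → (e j : ℕ) = (e i : ℕ) + 1

/-- The permutation `π` contains the generalized pattern `τ` exactly once. -/
def ContainedOnce {k n : ℕ} (τ : GeneralizedPattern k) (π : Equiv.Perm (Fin n)) : Prop :=
  ∃! e : Fin k ↪o Fin n, τ.IsOccurrence π e

/-- The pattern `1-3-2`. -/
def oneThreeTwo : GeneralizedPattern 3 where
  letter := ![1, 3, 2]
  glued := fun _ => False

/-- The pattern `12-3-⋯-k` (meant for `2 ≤ k`): only the first two letters are not separated
by a dash. -/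
def oneTwo (k : ℕ) : GeneralizedPattern k where
  letter := fun i => (i : ℕ) + 1
  glued := fun i => (i : ℕ) = 0

/-- The pattern `21-3-⋯-k` (meant for `2 ≤ k`): only the first two letters are not separated
by a dash. -/
def twoOne (k : ℕ) : GeneralizedPattern k where
  letter := fun i => if (i : ℕ) = 0 then 2 else if (i : ℕ) = 1 then 1 else (i : ℕ) + 1
  glued := fun i => (i : ℕ) = 0

/-- The generating function `Φ_τ(x) = ∑ₙ aₙ xⁿ`, where `aₙ` is the number of permutations of
`n` letters that contain `1-3-2` exactly once and contain `τ` exactly once. -/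
noncomputable def Phi {k : ℕ} (τ : GeneralizedPattern k) : PowerSeries ℚ :=
  PowerSeries.mk fun n =>
    (Nat.card {π : Equiv.Perm (Fin n) // oneThreeTwo.ContainedOnce π ∧ τ.ContainedOnce π} : ℚ)

end GeneralizedPattern

/-- The field of Hahn series in `x` with rational exponents and rational coefficients. It contains
`√x` and, via `HahnSeries.ofPowerSeries ℚ ℚ`, all formal power series in `x`. -/
abbrev XSeries : Type := HahnSeries ℚ ℚ

/-- The element `√x`, that is, `x` raised to the power `1 / 2`. -/
noncomputable def sqrtX : XSeries := HahnSeries.single (1 / 2 : ℚ) (1 : ℚ)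

/-- The value `U_p(t)` at `t = 1 / (2 √x)` of the Chebyshev polynomial of the second kind. -/
noncomputable def chebU (p : ℕ) : XSeries :=
  (Polynomial.Chebyshev.U XSeries (p : ℤ)).eval (1 / (2 * sqrtX))

/-!
A permutation is handled through its one-line notation, a word in the letters `0, …, n - 1`. Split
such a word at its largest letter `m` into `α m β`. If `1-3-2` is avoided, every letter of `α`
exceeds every letter of `β`, and `α`, `β` avoid `1-3-2`; this word is `glue α β`. If `1-3-2` occurs
once, either the word is again glued, and exactly one of `α`, `β` has an occurrence, or `m` is the
`3` of the occurrence `a m b`. In the last case `a` is the last letter of `α`, `b = a + 1` is the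
largest letter of `β`, and all other letters of `α` exceed those of `β` (`exists_eq_cross`); this
word is `cross α β`. So the words with at most one `1-3-2` are encoded by the trees `AvTree` and
`OnceTree`.

Let `e_k` be the number of occurrences of `12-3-⋯-k` or of `21-3-⋯-k`. Since an occurrence lies in
`α`, lies in `β`, or consists of an occurrence of the pattern with `k - 1` letters in `α` and of `m`,
`e_k(glue α β) = e_k(α) + e_(k-1)(α) + e_k(β)` (`occ_succ_glue`). The same holds for `cross α β`,
except that for `21-3` one more occurrence begins with the letter before `a` if there is one
(`occ_succ_cross`). A word with at most one occurrence of the pattern with `k - 1` letters has none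
of the pattern with `k` letters, the pattern `21` excepted. Hence the generating functions `A₀`, `A₁`
of the words avoiding `1-3-2` with `e_k = 0` and `e_k = 1`, and the corresponding `B₀`, `B₁` for
words with one `1-3-2`, satisfy a linear recurrence in `k` (`Recurrence`), with separate starting
values for `12` and for `21-3`, where the number of descents and of occurrences of `21-3` has to be
controlled together.

With `s = √x` the relation `s U_(k+1) = U_k - s U_(k-1)` yields `A₀ = U_(k-1) / (s U_k)`. The
recurrence then shows that `A₁ U_k²` is constant, that `B₀ U_k²` grows by `x U_(k-2)²`, and, by
`U_(k-2) U_k = U_(k-1)² - 1`, that `B₁ U_k²` grows by the summands of the sums in the formulas, up to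
a factor independent of `k`
(`Recurrence.step`, `ClosedForm`).
-/

namespace OneThreeTwoOnce

/-! ### Standard words and occurrences of `1-3-2` -/

/-- A word in the letters `0, …, n - 1`, each used once, where `n` is the length of the word:
the one-line notation of a permutation. -/
def Standard (l : List ℕ) : Prop := l.Perm (List.range l.length)

/-- The letters `t = (a, b, c)` of `l` form an occurrence of `1-3-2`. In a word without repeated
letters the letters of an occurrence determine their positions. -/
def Is132 (l : List ℕ) (t : ℕ × ℕ × ℕ) : Prop :=
  [t.1, t.2.1, t.2.2].Sublist l ∧ t.1 < t.2.2 ∧ t.2.2 < t.2.1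

/-- The word `l` has no occurrence of `1-3-2`. -/
def Avoids (l : List ℕ) : Prop := ∀ t, ¬ Is132 l t

/-- The word `l` has exactly one occurrence of `1-3-2`. -/
def Once (l : List ℕ) : Prop := ∃! t, Is132 l t

theorem Standard.nodup {l : List ℕ} (h : Standard l) : l.Nodup :=
  h.nodup_iff.2 List.nodup_range

theorem Standard.mem_iff {l : List ℕ} (h : Standard l) {v : ℕ} : v ∈ l ↔ v < l.length := by
  rw [List.Perm.mem_iff h, List.mem_range]

theorem standard_of_nodup {l : List ℕ} (h : l.Nodup) (h' : ∀ v ∈ l, v < l.length) :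
    Standard l := by
  have : l.Subperm (List.range l.length) := h.subperm fun v hv => List.mem_range.2 (h' v hv)
  exact this.perm_of_length_le (by simp)

theorem Standard.countP_lt {l : List ℕ} (h : Standard l) {c : ℕ} (hc : c ≤ l.length) :
    l.countP (· < c) = c := by
  rw [List.Perm.countP_eq _ h]
  obtain ⟨d, hd⟩ := Nat.exists_eq_add_of_le hc
  rw [hd, List.range_add, List.countP_append, List.countP_map]
  have h1 : (List.range c).countP (· < c) = (List.range c).length :=
    List.countP_eq_length.2 (by simp)
  have h2 : (List.range d).countP ((fun x => decide (x < c)) ∘ fun x => c + x) = 0 :=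
    List.countP_eq_zero.2 (by simp)
  rw [h1, h2]; simp

theorem three_sublist_append {a b c : ℕ} {p q : List ℕ} :
    [a, b, c].Sublist (p ++ q) ↔ [a, b, c].Sublist p ∨ ([a, b].Sublist p ∧ c ∈ q) ∨
      (a ∈ p ∧ [b, c].Sublist q) ∨ [a, b, c].Sublist q := by
  constructor
  · intro h
    obtain ⟨l₁, l₂, h, h₁, h₂⟩ := List.sublist_append_iff.1 h
    rcases l₁ with _ | ⟨x, _ | ⟨y, _ | ⟨z, _ | ⟨w, l⟩⟩⟩⟩ <;> simp_all
    obtain ⟨rfl, rfl, rfl⟩ := h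
    simp only [List.singleton_sublist] at h₂
    simp [h₂]
  · rintro (h | ⟨h, h'⟩ | ⟨h, h'⟩ | h)
    · exact h.trans (List.sublist_append_left _ _)
    · exact List.Sublist.append h (List.singleton_sublist.2 h')
    · exact List.Sublist.append (List.singleton_sublist.2 h) h'
    · exact h.trans (List.sublist_append_right _ _)

theorem Is132.mem {l : List ℕ} {t : ℕ × ℕ × ℕ} (h : Is132 l t) :
    t.1 ∈ l ∧ t.2.1 ∈ l ∧ t.2.2 ∈ l :=
  ⟨h.1.subset (by simp), h.1.subset (by simp), h.1.subset (by simp)⟩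

/-- The largest letter `m` creates no `1-3-2` when everything to its left exceeds everything to
its right, and then no occurrence straddles `m`. -/
theorem is132_append_cons {α β : List ℕ} {m : ℕ} (hα : ∀ v ∈ α, v < m) (hβ : ∀ v ∈ β, v < m)
    (h : ∀ v ∈ α, ∀ w ∈ β, w < v) (t : ℕ × ℕ × ℕ) :
    Is132 (α ++ m :: β) t ↔ Is132 α t ∨ Is132 β t := by
  obtain ⟨a, b, c⟩ := t
  constructor
  · rintro ⟨hs, hac, hcb⟩
    simp only at hs hac hcb
    rcases three_sublist_append.1 hs with h1 | ⟨h1, h2⟩ | ⟨h1, h2⟩ | h1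
    · exact .inl ⟨h1, hac, hcb⟩
    · have ha : a ∈ α := h1.subset (by simp)
      have hb : b ∈ α := h1.subset (by simp)
      have := hα _ ha
      have := hα _ hb
      rcases List.mem_cons.1 h2 with rfl | h2
      · omega
      · have := h _ ha _ h2
        omega
    · have := hα _ h1
      rcases List.sublist_cons_iff.1 h2 with h2 | ⟨r, h2, h3⟩
      · have hc : c ∈ β := h2.subset (by simp)
        have := h _ h1 _ hc
        omega
      · simp only [List.cons.injEq] at h2
        obtain ⟨rfl, rfl⟩ := h2
        have hc : c ∈ β := h3.subset (by simp)
        have := h _ h1 _ hc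
        omega
    · rcases List.sublist_cons_iff.1 h1 with h2 | ⟨r, h2, h3⟩
      · exact .inr ⟨h2, hac, hcb⟩
      · simp only [List.cons.injEq] at h2
        obtain ⟨rfl, rfl⟩ := h2
        have hb : b ∈ β := h3.subset (by simp)
        have hc : c ∈ β := h3.subset (by simp)
        have := hβ _ hb
        have := hβ _ hc
        omega
  · rintro (⟨h1, h2⟩ | ⟨h1, h2⟩)
    · exact ⟨h1.trans (List.sublist_append_left _ _), h2⟩
    · exact ⟨h1.trans ((List.sublist_cons_self _ _).trans (List.sublist_append_right _ _)), h2⟩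

/-- If the letters before the largest letter `m` end in `a`, and `a` and `b` are the only letters
left and right of `m` that are not in decreasing order, then `a m b` is the only occurrence of
`1-3-2` outside `α` and `β`. -/
theorem is132_append_cons_cons {α β : List ℕ} {a b m : ℕ} (hα : ∀ v ∈ α, v < m)
    (ham : a < m) (hβ : ∀ v ∈ β, v < m) (haα : ∀ v ∈ α, a < v)
    (h : ∀ v ∈ α, ∀ w ∈ β, w < v) (hb : b ∈ β) (hab : a < b) (hβa : ∀ v ∈ β, v ≠ b → v < a)
    (t : ℕ × ℕ × ℕ) :
    Is132 (α ++ a :: m :: β) t ↔ Is132 α t ∨ Is132 β t ∨ t = (a, m, b) := by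
  obtain ⟨x, y, z⟩ := t
  constructor
  · rintro ⟨hs, hxz, hzy⟩
    simp only at hs hxz hzy
    rcases three_sublist_append.1 hs with h1 | ⟨h1, h2⟩ | ⟨h1, h2⟩ | h1
    · exact .inl ⟨h1, hxz, hzy⟩
    · have hx : x ∈ α := h1.subset (by simp)
      have hy : y ∈ α := h1.subset (by simp)
      have := hα _ hy
      have := haα _ hx
      simp only [List.mem_cons] at h2
      rcases h2 with rfl | rfl | h2
      · omega
      · omega
      · have := h _ hx _ h2
        omega
    · have := haα _ h1
      have hz : z ∈ a :: m :: β := h2.subset (by simp)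
      have hy : y ∈ a :: m :: β := h2.subset (by simp)
      simp only [List.mem_cons] at hz hy
      rcases hz with rfl | rfl | hz
      · omega
      · rcases hy with rfl | rfl | hy
        · omega
        · omega
        · have := hβ _ hy
          omega
      · have := h _ h1 _ hz
        omega
    · rcases List.sublist_cons_iff.1 h1 with h2 | ⟨r, h2, h3⟩
      · rcases List.sublist_cons_iff.1 h2 with h2 | ⟨r, h2, h3⟩
        · exact .inr (.inl ⟨h2, hxz, hzy⟩)
        · simp only [List.cons.injEq] at h2
          obtain ⟨rfl, rfl⟩ := h2
          have hz : z ∈ β := h3.subset (by simp)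
          have := hβ _ hz
          omega
      · simp only [List.cons.injEq] at h2
        obtain ⟨rfl, rfl⟩ := h2
        rcases List.sublist_cons_iff.1 h3 with h2 | ⟨r, h2, h3⟩
        · have hy : y ∈ β := h2.subset (by simp)
          have hz : z ∈ β := h2.subset (by simp)
          have hyb : y = b := by
            by_contra hne
            have := hβa _ hy hne
            omega
          have hzb : z = b := by
            by_contra hne
            have := hβa _ hz hne
            omega
          omega
        · simp only [List.cons.injEq] at h2
          obtain ⟨rfl, rfl⟩ := h2
          have hz : z ∈ β := h3.subset (by simp)
          have hzb : z = b := by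
            by_contra hne
            have := hβa _ hz hne
            omega
          subst hzb
          exact .inr (.inr rfl)
  · rintro (⟨h1, h2⟩ | ⟨h1, h2⟩ | h1)
    · exact ⟨h1.trans (List.sublist_append_left _ _), h2⟩
    · exact ⟨h1.trans ((List.sublist_cons_self _ _).trans ((List.sublist_cons_self _ _).trans
        (List.sublist_append_right _ _))), h2⟩
    · simp only [Prod.mk.injEq] at h1
      obtain ⟨rfl, rfl, rfl⟩ := h1
      refine ⟨?_, hab, hβ _ hb⟩
      exact List.Sublist.trans
        ((List.singleton_sublist.2 hb).cons_cons _ |>.cons_cons _) (List.sublist_append_right _ _)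

theorem is132_map {f : ℕ → ℕ} (hf : StrictMono f) {l : List ℕ} {t : ℕ × ℕ × ℕ} :
    Is132 (l.map f) t ↔ ∃ u, Is132 l u ∧ t = (f u.1, f u.2.1, f u.2.2) := by
  constructor
  · rintro ⟨h1, h2, h3⟩
    obtain ⟨l', hl', h⟩ := List.sublist_map_iff.1 h1
    rcases l' with _ | ⟨x, _ | ⟨y, _ | ⟨z, _ | ⟨w, l⟩⟩⟩⟩ <;> simp at h
    obtain ⟨h4, h5, h6⟩ := h
    rw [h4, h6, hf.lt_iff_lt] at h2
    rw [h5, h6, hf.lt_iff_lt] at h3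
    exact ⟨(x, y, z), ⟨hl', h2, h3⟩, by ext <;> simp [h4, h5, h6]⟩
  · rintro ⟨u, ⟨h1, h2, h3⟩, rfl⟩
    exact ⟨h1.map f, hf h2, hf h3⟩

theorem avoids_map {f : ℕ → ℕ} (hf : StrictMono f) {l : List ℕ} :
    Avoids (l.map f) ↔ Avoids l := by
  simp only [Avoids, is132_map hf]
  constructor
  · exact fun h u hu => h _ ⟨u, hu, rfl⟩
  · rintro h t ⟨u, hu, -⟩
    exact h u hu

theorem once_map {f : ℕ → ℕ} (hf : StrictMono f) {l : List ℕ} :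
    Once (l.map f) ↔ Once l := by
  simp only [Once, is132_map hf]
  constructor
  · rintro ⟨t, ⟨u, hu, rfl⟩, h⟩
    refine ⟨u, hu, fun v hv => ?_⟩
    have := h _ ⟨v, hv, rfl⟩
    simp only [Prod.mk.injEq, hf.injective.eq_iff] at this
    ext <;> simp [this]
  · rintro ⟨u, hu, h⟩
    refine ⟨_, ⟨u, hu, rfl⟩, ?_⟩
    rintro t ⟨v, hv, rfl⟩
    rw [h v hv]

/-! ### Building words around their largest letter -/

/-- The word `α' m β`, where `m` is larger than all other letters and `α'` is a translate of `α`
all of whose letters exceed those of `β`. -/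
def glue (α β : List ℕ) : List ℕ :=
  α.map (· + β.length) ++ (α.length + β.length) :: β

/-- The increasing map that omits the value `k - 1`. -/
def bump (k v : ℕ) : ℕ := if v + 1 < k then v else v + 1

/-- The word `α' a m β'`, where `m` is the largest letter, `a = |β| - 1`, the word `β'` is `β` with
its largest letter raised from `a` to `a + 1`, and `α'` is a translate of `α` all of whose letters
exceed `a + 1` (meant for nonempty `β`). -/
def cross (α β : List ℕ) : List ℕ :=
  α.map (· + (β.length + 1)) ++
    (β.length - 1) :: (α.length + β.length + 1) :: β.map (bump β.length)

theorem strictMono_bump (k : ℕ) : StrictMono (bump k) := by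
  intro v w h
  unfold bump
  split_ifs <;> omega

theorem strictMono_add (k : ℕ) : StrictMono (· + k) := fun v w h => by
  simp only; omega

@[simp] theorem length_glue (α β : List ℕ) :
    (glue α β).length = α.length + β.length + 1 := by
  simp [glue]; omega

@[simp] theorem length_cross (α β : List ℕ) :
    (cross α β).length = α.length + β.length + 2 := by
  simp [cross]; omega

theorem Standard.glue {α β : List ℕ} (hα : Standard α) (hβ : Standard β) :
    Standard (glue α β) := by
  apply standard_of_nodup
  · rw [OneThreeTwoOnce.glue, List.nodup_append]
    refine ⟨hα.nodup.map (strictMono_add _).injective, ?_, ?_⟩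
    · rw [List.nodup_cons]
      refine ⟨fun h => ?_, hβ.nodup⟩
      have := hβ.mem_iff.1 h
      omega
    · simp only [List.mem_map, List.mem_cons, ne_eq, forall_exists_index, and_imp]
      rintro _ v hv rfl w (rfl | hw)
      · have := hα.mem_iff.1 hv
        omega
      · have := hβ.mem_iff.1 hw
        omega
  · rw [length_glue]
    simp only [OneThreeTwoOnce.glue, List.mem_append, List.mem_map, List.mem_cons]
    rintro _ (⟨v, hv, rfl⟩ | rfl | hv)
    · have := hα.mem_iff.1 hv
      omega
    · omega
    · have := hβ.mem_iff.1 hv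
      omega

theorem bump_lt {k v : ℕ} (h : v < k) : bump k v + 1 < k ∨ bump k v = k := by
  unfold bump
  split_ifs <;> omega

theorem Standard.cross {α β : List ℕ} (hα : Standard α) (hβ : Standard β) (h0 : β ≠ []) :
    Standard (cross α β) := by
  have hpos := List.length_pos_of_ne_nil h0
  apply standard_of_nodup
  · rw [OneThreeTwoOnce.cross, List.nodup_append]
    refine ⟨hα.nodup.map (strictMono_add _).injective, ?_, ?_⟩
    · rw [List.nodup_cons, List.nodup_cons]
      refine ⟨fun h => ?_, fun h => ?_, hβ.nodup.map (strictMono_bump _).injective⟩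
      · simp only [List.mem_map, List.mem_cons] at h
        rcases h with h | ⟨v, hv, h⟩
        · omega
        · have := bump_lt (hβ.mem_iff.1 hv)
          omega
      · simp only [List.mem_map] at h
        obtain ⟨v, hv, h⟩ := h
        have := bump_lt (hβ.mem_iff.1 hv)
        omega
    · simp only [List.mem_map, List.mem_cons, ne_eq, forall_exists_index, and_imp]
      rintro _ v hv rfl w (rfl | rfl | ⟨u, hu, rfl⟩)
      · omega
      · have := hα.mem_iff.1 hv
        omega
      · have := bump_lt (hβ.mem_iff.1 hu)
        omega
  · rw [length_cross]
    simp only [OneThreeTwoOnce.cross, List.mem_append, List.mem_map, List.mem_cons]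
    rintro _ (⟨v, hv, rfl⟩ | rfl | rfl | ⟨v, hv, rfl⟩)
    · have := hα.mem_iff.1 hv
      omega
    · omega
    · omega
    · have := bump_lt (hβ.mem_iff.1 hv)
      omega

theorem is132_glue {α β : List ℕ} (hα : Standard α) (hβ : Standard β) (t : ℕ × ℕ × ℕ) :
    Is132 (glue α β) t ↔ Is132 (α.map (· + β.length)) t ∨ Is132 β t := by
  apply is132_append_cons
  · simp only [List.mem_map]
    rintro _ ⟨v, hv, rfl⟩
    have := hα.mem_iff.1 hv
    omega
  · intro v hv
    have := hβ.mem_iff.1 hv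
    omega
  · simp only [List.mem_map]
    rintro _ ⟨v, hv, rfl⟩ w hw
    have := hβ.mem_iff.1 hw
    omega

theorem avoids_glue {α β : List ℕ} (hα : Standard α) (hβ : Standard β) :
    Avoids (glue α β) ↔ Avoids α ∧ Avoids β := by
  rw [← avoids_map (strictMono_add β.length) (l := α)]
  simp only [Avoids, is132_glue hα hβ, not_or, forall_and]

theorem existsUnique_or {γ : Type*} {P Q : γ → Prop} (h : ∀ t, P t → ¬ Q t) :
    (∃! t, P t ∨ Q t) ↔ ((∃! t, P t) ∧ ∀ t, ¬ Q t) ∨ ((∀ t, ¬ P t) ∧ ∃! t, Q t) := by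
  constructor
  · rintro ⟨t, ht | ht, hu⟩
    · refine .inl ⟨⟨t, ht, fun s hs => hu s (.inl hs)⟩, fun s hs => ?_⟩
      have := hu s (.inr hs)
      subst this
      exact h _ ht hs
    · refine .inr ⟨fun s hs => ?_, ⟨t, ht, fun s hs => hu s (.inr hs)⟩⟩
      have := hu s (.inl hs)
      subst this
      exact h _ hs ht
  · rintro (⟨⟨t, ht, hu⟩, hn⟩ | ⟨hn, ⟨t, ht, hu⟩⟩)
    · exact ⟨t, .inl ht, fun s hs => hu s (hs.resolve_right (hn s))⟩
    · exact ⟨t, .inr ht, fun s hs => hu s (hs.resolve_left (hn s))⟩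

theorem once_glue {α β : List ℕ} (hα : Standard α) (hβ : Standard β) :
    Once (glue α β) ↔ (Once α ∧ Avoids β) ∨ (Avoids α ∧ Once β) := by
  rw [← avoids_map (strictMono_add β.length) (l := α),
    ← once_map (strictMono_add β.length) (l := α)]
  simp only [Once, Avoids, is132_glue hα hβ]
  apply existsUnique_or
  intro t h1 h2
  have h3 := hβ.mem_iff.1 h2.mem.1
  have h4 := h1.mem.1
  simp only [List.mem_map] at h4
  obtain ⟨v, -, h4⟩ := h4
  omega

theorem once_cross {α β : List ℕ} (hα : Standard α) (hβ : Standard β) (h0 : β ≠ [])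
    (h1 : Avoids α) (h2 : Avoids β) : Once (cross α β) := by
  have hpos := List.length_pos_of_ne_nil h0
  have key := is132_append_cons_cons (α := α.map (· + (β.length + 1)))
    (β := β.map (bump β.length)) (a := β.length - 1) (b := β.length)
    (m := α.length + β.length + 1)
    (by
      simp only [List.mem_map]
      rintro _ ⟨v, hv, rfl⟩
      have := hα.mem_iff.1 hv
      omega) (by omega)
    (by
      simp only [List.mem_map]
      rintro _ ⟨v, hv, rfl⟩
      have := bump_lt (hβ.mem_iff.1 hv)
      omega)
    (by
      simp only [List.mem_map]
      rintro _ ⟨v, hv, rfl⟩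
      omega)
    (by
      simp only [List.mem_map]
      rintro _ ⟨v, hv, rfl⟩ _ ⟨w, hw, rfl⟩
      have := bump_lt (hβ.mem_iff.1 hw)
      omega)
    (List.mem_map.2 ⟨β.length - 1, hβ.mem_iff.2 (by omega), by
      unfold bump
      split_ifs <;> omega⟩) (by omega)
    (by
      simp only [List.mem_map]
      rintro _ ⟨v, hv, rfl⟩ hne
      have := bump_lt (hβ.mem_iff.1 hv)
      omega)
  refine ⟨_, (key _).2 (.inr (.inr rfl)), fun t ht => ?_⟩
  rcases (key t).1 ht with h | h | h
  · exact absurd h ((avoids_map (strictMono_add _)).2 h1 t)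
  · exact absurd h ((avoids_map (strictMono_bump _)).2 h2 t)
  · exact h

theorem glue_injective {α β α' β' : List ℕ} (hα : Standard α) (hβ : Standard β)
    (h : glue α β = glue α' β') : α = α' ∧ β = β' := by
  have hlen := congrArg List.length h
  simp only [length_glue] at hlen
  have hlen' : α'.length + β'.length = α.length + β.length := by omega
  rw [glue, glue, hlen'] at h
  have h1 : α.length + β.length ∉ α.map (· + β.length) := by
    simp only [List.mem_map, not_exists, not_and]
    intro v hv
    have := hα.mem_iff.1 hv
    omega
  have h3 : α.length + β.length ∉ β := fun h => by
    have := hβ.mem_iff.1 h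
    omega
  obtain ⟨h5, h6, h7⟩ := (List.append_cons_inj_of_notMem h1 h3).1 h
  refine ⟨?_, h7⟩
  rw [← h7] at h5
  exact (List.map_injective_iff.2 (strictMono_add _).injective) h5

theorem cross_injective {α β α' β' : List ℕ} (hα : Standard α) (hβ : Standard β)
    (h : cross α β = cross α' β') : α = α' ∧ β = β' := by
  have hlen := congrArg List.length h
  simp only [length_cross] at hlen
  have hlen' : α'.length + β'.length = α.length + β.length := by omega
  have e : ∀ a b : List ℕ, cross a b = (a.map (· + (b.length + 1)) ++ [b.length - 1]) ++
      (a.length + b.length + 1) :: b.map (bump b.length) := by simp [cross]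
  rw [e, e, hlen'] at h
  have aux : ∀ a b : List ℕ, Standard a → Standard b → a.length + b.length =
      α.length + β.length →
      α.length + β.length + 1 ∉ a.map (· + (b.length + 1)) ++ [b.length - 1] ∧
      α.length + β.length + 1 ∉ b.map (bump b.length) := by
    intro a b ha hb hab
    simp only [List.mem_append, List.mem_map, List.mem_singleton, not_or, not_exists, not_and]
    refine ⟨⟨fun v hv => ?_, by omega⟩, fun v hv => ?_⟩
    · have := ha.mem_iff.1 hv
      omega
    · have := bump_lt (hb.mem_iff.1 hv)
      omega
  obtain ⟨h1, h3⟩ := aux α β hα hβ rfl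
  obtain ⟨h5, h6, h7⟩ := (List.append_cons_inj_of_notMem h1 h3).1 h
  have hb : β.length = β'.length := by simpa using congrArg List.length h7
  rw [← hb] at h5 h7
  rw [List.append_cancel_right_eq] at h5
  exact ⟨(List.map_injective_iff.2 (strictMono_add _).injective) h5,
    (List.map_injective_iff.2 (strictMono_bump _).injective) h7⟩

theorem glue_ne_cross {α β α' β' : List ℕ} (hα : Standard α) (hβ : Standard β)
    (h0 : β' ≠ []) : glue α β ≠ cross α' β' := by
  intro h
  have hpos := List.length_pos_of_ne_nil h0
  have hlen := congrArg List.length h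
  simp only [length_glue, length_cross] at hlen
  have hlen' : α.length + β.length = α'.length + β'.length + 1 := by omega
  have e : cross α' β' = (α'.map (· + (β'.length + 1)) ++ [β'.length - 1]) ++
      (α'.length + β'.length + 1) :: β'.map (bump β'.length) := by simp [cross]
  rw [e, glue, hlen'] at h
  have h1 : α'.length + β'.length + 1 ∉ α.map (· + β.length) := by
    simp only [List.mem_map, not_exists, not_and]
    intro v hv
    have := hα.mem_iff.1 hv
    omega
  have h3 : α'.length + β'.length + 1 ∉ β := fun h => by
    have := hβ.mem_iff.1 h
    omega
  obtain ⟨h5, h6, h7⟩ := (List.append_cons_inj_of_notMem h1 h3).1 h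
  have hb : β.length = β'.length := by simpa using congrArg List.length h7
  have : β'.length - 1 ∈ α.map (· + β.length) := by rw [h5]; simp
  simp only [List.mem_map] at this
  obtain ⟨v, -, h⟩ := this
  omega

theorem Standard.exists_append_cons {l : List ℕ} (h : Standard l) (h0 : l ≠ []) :
    ∃ α β, l = α ++ (α.length + β.length) :: β := by
  have hpos := List.length_pos_of_ne_nil h0
  obtain ⟨α, β, hl⟩ := List.append_of_mem (h.mem_iff.2 (Nat.sub_lt hpos one_pos))
  refine ⟨α, β, ?_⟩
  have : l.length - 1 = α.length + β.length := by
    rw [congrArg List.length hl]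
    simp only [List.length_append, List.length_cons]
    omega
  rwa [this] at hl

theorem exists_map_add_eq {α : List ℕ} {k : ℕ} (h : ∀ v ∈ α, k ≤ v) :
    ∃ α' : List ℕ, α = α'.map (· + k) := by
  refine ⟨α.map (· - k), ?_⟩
  rw [List.map_map]
  refine ((List.map_congr_left fun v hv => ?_).trans (List.map_id _)).symm
  have := h v hv
  simp only [Function.comp, id]
  omega

/-- If every letter left of the largest one exceeds every letter right of it, the word is glued
from two standard words. -/
theorem exists_eq_glue {α β : List ℕ} (hl : Standard (α ++ (α.length + β.length) :: β))
    (h : ∀ v ∈ α, ∀ w ∈ β, w < v) :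
    ∃ α' β', Standard α' ∧ Standard β' ∧ α ++ (α.length + β.length) :: β = glue α' β' := by
  have hnd := hl.nodup
  have hm := fun v => hl.mem_iff (v := v)
  rw [List.nodup_append, List.nodup_cons] at hnd
  obtain ⟨hnα, ⟨hmβ, hnβ⟩, hdis⟩ := hnd
  have hlen : (α ++ (α.length + β.length) :: β).length = α.length + β.length + 1 := by
    simp only [List.length_append, List.length_cons]; omega
  simp only [hlen] at hm
  have hltα : ∀ v ∈ α, v < α.length + β.length := fun v hv => by
    have h1 := (hm _).1 (List.mem_append_left _ hv)
    have h2 := hdis v hv _ List.mem_cons_self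
    omega
  have hltβ : ∀ v ∈ β, v < α.length + β.length := fun v hv => by
    have h1 := (hm _).1 (List.mem_append_right _ (List.mem_cons_of_mem _ hv))
    have h2 : v ≠ α.length + β.length := fun h => hmβ (h ▸ hv)
    omega
  have hβ : ∀ v ∈ β, v < β.length := by
    intro v hv
    have h1 := hl.countP_lt (c := v + 1) (by have := hltβ v hv; omega)
    rw [List.countP_append, List.countP_cons_of_neg (by have := hltβ v hv; simp; omega)] at h1
    have h2 : α.countP (· < v + 1) = 0 := List.countP_eq_zero.2 fun w hw => by
      have := h w hw v hv
      simp; omega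
    have h3 := List.countP_le_length (p := fun x => decide (x < v + 1)) (l := β)
    omega
  have hα : ∀ v ∈ α, β.length ≤ v := by
    intro v hv
    have h1 := hl.countP_lt (c := v) (by have := hltα v hv; omega)
    rw [List.countP_append, List.countP_cons_of_neg (by have := hltα v hv; simp; omega)] at h1
    have h2 : β.countP (· < v) = β.length := List.countP_eq_length.2 fun w hw => by
      have := h v hv w hw
      simpa
    omega
  obtain ⟨α', rfl⟩ := exists_map_add_eq hα
  refine ⟨α', β, standard_of_nodup (List.Nodup.of_map _ hnα) fun v hv => ?_,
    standard_of_nodup hnβ hβ, ?_⟩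
  · have := hltα _ (List.mem_map_of_mem hv)
    simp only [List.length_map] at this
    omega
  · simp [glue]

/-- If some letter left of the largest one is smaller than some letter right of it, and `1-3-2`
occurs only once, the word is a crossed word. -/
theorem exists_eq_cross {α β : List ℕ} (hl : Standard (α ++ (α.length + β.length) :: β))
    (h1 : Once (α ++ (α.length + β.length) :: β)) {a b : ℕ} (ha : a ∈ α) (hb : b ∈ β)
    (hab : a < b) :
    ∃ α' β', Standard α' ∧ Standard β' ∧ β' ≠ [] ∧ Avoids α' ∧ Avoids β' ∧
      α ++ (α.length + β.length) :: β = cross α' β' := by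
  have hnd := hl.nodup
  have hm := fun v => hl.mem_iff (v := v)
  rw [List.nodup_append, List.nodup_cons] at hnd
  obtain ⟨hnα, ⟨hmβ, hnβ⟩, hdis⟩ := hnd
  have hlen : (α ++ (α.length + β.length) :: β).length = α.length + β.length + 1 := by
    simp only [List.length_append, List.length_cons]; omega
  simp only [hlen] at hm
  generalize hM : α.length + β.length = m at *
  have hlt : ∀ v, v < m → v + 1 ≤ (α ++ m :: β).length := fun v hv => by
    rw [hlen]; omega
  have hltα : ∀ v ∈ α, v < m := fun v hv => by
    have h1 := (hm _).1 (List.mem_append_left _ hv)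
    have h2 := hdis v hv _ List.mem_cons_self
    omega
  have hltβ : ∀ v ∈ β, v < m := fun v hv => by
    have h1 := (hm _).1 (List.mem_append_right _ (List.mem_cons_of_mem _ hv))
    have h2 : v ≠ m := fun h => hmβ (h ▸ hv)
    omega
  -- every pair of letters `v < w` separated by `m` yields an occurrence `v m w`
  have hocc : ∀ v ∈ α, ∀ w ∈ β, v < w → Is132 (α ++ m :: β) (v, m, w) := fun v hv w hw hvw =>
    ⟨List.Sublist.append (List.singleton_sublist.2 hv)
      ((List.singleton_sublist.2 hw).cons_cons _), hvw, hltβ w hw⟩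
  have huniq : ∀ t, Is132 (α ++ m :: β) t → t = (a, m, b) := fun t ht =>
    h1.unique ht (hocc a ha b hb hab)
  have hpair : ∀ v ∈ α, ∀ w ∈ β, v < w → v = a ∧ w = b := fun v hv w hw hvw => by
    have := huniq _ (hocc v hv w hw hvw)
    simp only [Prod.mk.injEq] at this
    exact ⟨this.1, this.2.2⟩
  have hne : ∀ v ∈ α, ∀ w ∈ β, v ≠ w := fun v hv w hw => hdis v hv w (List.mem_cons_of_mem _ hw)
  have hβa : ∀ w ∈ β, w ≠ b → w < a := fun w hw hwb => by
    have h2 := hne a ha w hw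
    by_contra h3
    exact hwb (hpair a ha w hw (by omega)).2
  have hαb : ∀ v ∈ α, v ≠ a → b < v := fun v hv hva => by
    have h2 := hne v hv b hb
    by_contra h3
    exact hva (hpair v hv b hb (by omega)).1
  have hAα : Avoids α := fun t ht => by
    have h2 := huniq t ⟨ht.1.trans (List.sublist_append_left _ _), ht.2⟩
    have h3 := hltα _ ht.mem.2.1
    rw [h2] at h3
    exact lt_irrefl _ h3
  have hAβ : Avoids β := fun t ht => by
    have h2 := huniq t ⟨ht.1.trans ((List.sublist_cons_self _ _).trans
      (List.sublist_append_right _ _)), ht.2⟩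
    have h3 := hltβ _ ht.mem.2.1
    rw [h2] at h3
    exact lt_irrefl _ h3
  -- a letter `y` of `α` after `a` would give the second occurrence `a y b`
  have hlast : ∃ α₁, α = α₁ ++ [a] := by
    obtain ⟨α₁, α₂, rfl⟩ := List.append_of_mem ha
    rcases α₂ with _ | ⟨y, α₂⟩
    · exact ⟨α₁, rfl⟩
    · exfalso
      have hya : y ≠ a := by
        rintro rfl
        rw [List.nodup_append] at hnα
        simp at hnα
      have hyα : y ∈ α₁ ++ a :: y :: α₂ := by simp
      have h3 : Is132 ((α₁ ++ a :: y :: α₂) ++ m :: β) (a, y, b) := by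
        refine ⟨three_sublist_append.2 (.inr (.inl ⟨?_, List.mem_cons_of_mem _ hb⟩)), hab,
          hαb y hyα hya⟩
        exact List.Sublist.trans (by simp) (List.sublist_append_right _ _)
      have h4 := huniq _ h3
      simp only [Prod.mk.injEq] at h4
      have := hltα y hyα
      omega
  obtain ⟨α₁, rfl⟩ := hlast
  have hα₁ : ∀ v ∈ α₁, b < v := fun v hv => by
    refine hαb v (List.mem_append_left _ hv) ?_
    rintro rfl
    rw [List.nodup_append] at hnα
    exact hnα.2.2 v hv v (by simp) rfl
  have hb1 : b = β.length := by
    have h2 := hl.countP_lt (hlt b (hltβ b hb))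
    rw [List.countP_append, List.countP_append,
      List.countP_cons_of_neg (a := m) (by have := hltβ b hb; simp; omega)] at h2
    have h3 : α₁.countP (· < b + 1) = 0 := List.countP_eq_zero.2 fun w hw => by
      have := hα₁ w hw
      simp; omega
    have h4 : β.countP (· < b + 1) = β.length := List.countP_eq_length.2 fun w hw => by
      by_cases hwb : w = b
      · simp [hwb]
      · have := hβa w hw hwb
        simp; omega
    have h5 : [a].countP (· < b + 1) = 1 := by
      rw [List.countP_singleton, if_pos]; simp; omega
    omega
  have ha1 : a + 1 = b := by
    by_contra hne'
    have h2 : b - 1 ∈ α₁ ++ [a] ++ m :: β := (hm _).2 (by have := hltβ b hb; omega)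
    simp only [List.mem_append, List.mem_cons, List.not_mem_nil, or_false] at h2
    rcases h2 with (h2 | h2) | h2 | h2
    · have := hα₁ _ h2
      omega
    · omega
    · have := hltβ b hb
      omega
    · have := hβa _ h2 (by omega)
      omega
  obtain ⟨α', rfl⟩ := exists_map_add_eq (k := b + 1) (α := α₁) fun v hv => hα₁ v hv
  have hβ' : β = (β.map fun v => if v = b then v - 1 else v).map (bump b) := by
    rw [List.map_map]
    refine ((List.map_congr_left fun v hv => ?_).trans (List.map_id _)).symm
    have := hβa v hv
    simp only [Function.comp, id, bump]
    split_ifs <;> omega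
  have hsβ : Standard (β.map fun v => if v = b then v - 1 else v) := by
    refine standard_of_nodup (List.Nodup.of_map (bump b) (hβ' ▸ hnβ)) ?_
    simp only [List.mem_map, List.length_map]
    rintro _ ⟨v, hv, rfl⟩
    have := hβa v hv
    split_ifs <;> omega
  refine ⟨α', β.map fun v => if v = b then v - 1 else v, ?_, hsβ, ?_, ?_, ?_, ?_⟩
  · refine standard_of_nodup ?_ fun v hv => ?_
    · rw [List.nodup_append] at hnα
      exact List.Nodup.of_map _ hnα.1
    · have := hltα (v + (b + 1)) (List.mem_append_left _ (List.mem_map_of_mem hv))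
      simp only [List.length_append, List.length_map, List.length_cons, List.length_nil] at hM
      omega
  · intro h
    rw [List.map_eq_nil_iff] at h
    simp [h] at hb
  · rw [← avoids_map (strictMono_add (b + 1))]
    exact fun t ht => hAα t ⟨ht.1.trans (List.sublist_append_left _ _), ht.2⟩
  · rw [← avoids_map (strictMono_bump b), ← hβ']
    exact hAβ
  · simp only [List.length_append, List.length_map, List.length_cons, List.length_nil] at hM
    rw [cross, List.length_map, ← hb1, ← hβ', show b - 1 = a by omega,
      show α'.length + b + 1 = m by omega]
    simp

/-! ### Trees encoding the words with at most one `1-3-2` -/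

/-- Binary trees, encoding the words without `1-3-2`. -/
inductive AvTree : Type
  | nil : AvTree
  | node (l r : AvTree) : AvTree

/-- The word encoded by a tree: the root is the largest letter, everything to its left exceeds
everything to its right. -/
def AvTree.word : AvTree → List ℕ
  | .nil => []
  | .node l r => glue l.word r.word

/-- Trees encoding the words with exactly one `1-3-2`: either the occurrence lies to the left or to
the right of the largest letter, or the largest letter is its `3`. In the last case the right part
is nonempty and is given by the two subtrees `r₁` and `r₂` of its root. -/
inductive OnceTree : Type
  | left (o : OnceTree) (r : AvTree) : OnceTree
  | right (l : AvTree) (o : OnceTree) : OnceTree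
  | cross (l r₁ r₂ : AvTree) : OnceTree

/-- The word encoded by a tree. -/
def OnceTree.word : OnceTree → List ℕ
  | .left o r => glue o.word r.word
  | .right l o => glue l.word o.word
  | .cross l r₁ r₂ => OneThreeTwoOnce.cross l.word (glue r₁.word r₂.word)

theorem glue_ne_nil (α β : List ℕ) : glue α β ≠ [] := by
  simp [glue]

theorem AvTree.standard_word (T : AvTree) : Standard T.word := by
  induction T with
  | nil => exact List.Perm.refl _
  | node l r hl hr => exact hl.glue hr

theorem avoids_nil : Avoids [] := fun t h => by
  have := h.mem.1
  simp at this

theorem AvTree.avoids_word (T : AvTree) : Avoids T.word := by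
  induction T with
  | nil => exact avoids_nil
  | node l r hl hr => exact (avoids_glue l.standard_word r.standard_word).2 ⟨hl, hr⟩

theorem OnceTree.standard_word (T : OnceTree) : Standard T.word := by
  induction T with
  | left o r ho => exact ho.glue r.standard_word
  | right l o ho => exact l.standard_word.glue ho
  | cross l r₁ r₂ =>
    exact l.standard_word.cross (AvTree.node r₁ r₂).standard_word (glue_ne_nil _ _)

theorem OnceTree.once_word (T : OnceTree) : Once T.word := by
  induction T with
  | left o r ho => exact (once_glue o.standard_word r.standard_word).2 (.inl ⟨ho, r.avoids_word⟩)
  | right l o ho => exact (once_glue l.standard_word o.standard_word).2 (.inr ⟨l.avoids_word, ho⟩)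
  | cross l r₁ r₂ =>
    exact once_cross l.standard_word (AvTree.node r₁ r₂).standard_word (glue_ne_nil _ _)
      l.avoids_word (AvTree.node r₁ r₂).avoids_word

theorem Once.not_avoids {l : List ℕ} (h : Once l) : ¬ Avoids l := fun h' =>
  h' _ h.exists.choose_spec

theorem AvTree.word_injective : Function.Injective AvTree.word := by
  intro T
  induction T with
  | nil =>
    rintro (_ | ⟨l, r⟩) h
    · rfl
    · exact absurd h.symm (glue_ne_nil _ _)
  | node l r hl hr =>
    rintro (_ | ⟨l', r'⟩) h
    · exact absurd h (glue_ne_nil _ _)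
    · obtain ⟨h1, h2⟩ := glue_injective l.standard_word r.standard_word h
      rw [hl h1, hr h2]

theorem OnceTree.word_injective : Function.Injective OnceTree.word := by
  intro T
  induction T with
  | left o r ho =>
    rintro (⟨o', r'⟩ | ⟨l', o'⟩ | ⟨l', r₁', r₂'⟩) h
    · obtain ⟨h1, h2⟩ := glue_injective o.standard_word r.standard_word h
      rw [ho h1, AvTree.word_injective h2]
    · obtain ⟨h1, -⟩ := glue_injective o.standard_word r.standard_word h
      exact absurd (h1 ▸ l'.avoids_word) o.once_word.not_avoids
    · exact absurd h (glue_ne_cross o.standard_word r.standard_word (glue_ne_nil _ _))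
  | right l o ho =>
    rintro (⟨o', r'⟩ | ⟨l', o'⟩ | ⟨l', r₁', r₂'⟩) h
    · obtain ⟨h1, -⟩ := glue_injective l.standard_word o.standard_word h
      exact absurd (h1 ▸ l.avoids_word) o'.once_word.not_avoids
    · obtain ⟨h1, h2⟩ := glue_injective l.standard_word o.standard_word h
      rw [ho h2, AvTree.word_injective h1]
    · exact absurd h (glue_ne_cross l.standard_word o.standard_word (glue_ne_nil _ _))
  | cross l r₁ r₂ =>
    rintro (⟨o', r'⟩ | ⟨l', o'⟩ | ⟨l', r₁', r₂'⟩) h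
    · exact absurd h.symm (glue_ne_cross o'.standard_word r'.standard_word (glue_ne_nil _ _))
    · exact absurd h.symm (glue_ne_cross l'.standard_word o'.standard_word (glue_ne_nil _ _))
    · obtain ⟨h1, h2⟩ := cross_injective l.standard_word (AvTree.node r₁ r₂).standard_word h
      have h3 := AvTree.word_injective (a₁ := .node r₁ r₂) (a₂ := .node r₁' r₂') h2
      rw [AvTree.node.injEq] at h3
      rw [AvTree.word_injective h1, h3.1, h3.2]

theorem exists_avTree_word_eq {l : List ℕ} (hl : Standard l) (h : Avoids l) :
    ∃ T : AvTree, T.word = l := by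
  induction hn : l.length using Nat.strong_induction_on generalizing l with
  | _ n ih =>
  rcases eq_or_ne l [] with rfl | h0
  · exact ⟨.nil, rfl⟩
  obtain ⟨α, β, he⟩ := hl.exists_append_cons h0
  have key : ∀ v ∈ α, ∀ w ∈ β, w < v := by
    intro v hv w hw
    by_contra hvw
    have hnd := hl.nodup
    rw [he, List.nodup_append] at hnd
    have h1 := hnd.2.2 v hv w (List.mem_cons_of_mem _ hw)
    have h2 : w ≠ α.length + β.length := by
      rintro rfl
      exact (List.nodup_cons.1 hnd.2.1).1 hw
    have h3 : w < l.length := hl.mem_iff.1 (by rw [he]; simp [hw])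
    have h4 := congrArg List.length he
    simp only [List.length_append, List.length_cons] at h4
    refine h (v, α.length + β.length, w) ⟨?_, by simp only; omega, by simp only; omega⟩
    rw [he]
    exact List.Sublist.append (List.singleton_sublist.2 hv)
      ((List.singleton_sublist.2 hw).cons_cons _)
  subst he
  obtain ⟨α', β', hα', hβ', he⟩ := exists_eq_glue hl key
  rw [he] at h hn ⊢
  rw [avoids_glue hα' hβ'] at h
  rw [length_glue] at hn
  obtain ⟨l, rfl⟩ := ih _ (by omega) hα' h.1 rfl
  obtain ⟨r, rfl⟩ := ih _ (by omega) hβ' h.2 rfl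
  exact ⟨.node l r, rfl⟩

theorem exists_onceTree_word_eq {l : List ℕ} (hl : Standard l) (h : Once l) :
    ∃ T : OnceTree, T.word = l := by
  induction hn : l.length using Nat.strong_induction_on generalizing l with
  | _ n ih =>
  rcases eq_or_ne l [] with rfl | h0
  · exact absurd avoids_nil h.not_avoids
  obtain ⟨α, β, rfl⟩ := hl.exists_append_cons h0
  by_cases key : ∀ v ∈ α, ∀ w ∈ β, w < v
  · obtain ⟨α', β', hα', hβ', he⟩ := exists_eq_glue hl key
    rw [he] at h hn ⊢
    rw [length_glue] at hn
    rcases (once_glue hα' hβ').1 h with h | h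
    · obtain ⟨o, rfl⟩ := ih _ (by omega) hα' h.1 rfl
      obtain ⟨r, rfl⟩ := exists_avTree_word_eq hβ' h.2
      exact ⟨.left o r, rfl⟩
    · obtain ⟨o, rfl⟩ := ih _ (by omega) hβ' h.2 rfl
      obtain ⟨l, rfl⟩ := exists_avTree_word_eq hα' h.1
      exact ⟨.right l o, rfl⟩
  · push Not at key
    obtain ⟨v, hv, w, hw, hvw⟩ := key
    have hne : v ≠ w :=
      (List.nodup_append.1 hl.nodup).2.2 v hv w (List.mem_cons_of_mem _ hw)
    obtain ⟨α', β', hα', hβ', hβ0, h1, h2, he⟩ :=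
      exists_eq_cross hl h hv hw (lt_of_le_of_ne hvw hne)
    rw [he]
    obtain ⟨l, rfl⟩ := exists_avTree_word_eq hα' h1
    obtain ⟨_ | ⟨r₁, r₂⟩, rfl⟩ := exists_avTree_word_eq hβ' h2
    · exact absurd rfl hβ0
    · exact ⟨.cross l r₁ r₂, rfl⟩

/-! ### Generating functions -/

open PowerSeries

/-- A type with a size for which there are only finitely many elements of each size. -/
class Sized (γ : Type) where
  /-- the size of an element -/
  size : γ → ℕ
  finite_size : ∀ n, {a | size a = n}.Finite

/-- The generating function `∑ w(a) x ^ |a|` of a weight `w`. -/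
noncomputable def genFun {γ : Type} [Sized γ] (w : γ → ℚ) : PowerSeries ℚ :=
  PowerSeries.mk fun n => ∑ a ∈ (Sized.finite_size (γ := γ) n).toFinset, w a

instance {γ δ : Type} [Sized γ] [Sized δ] : Sized (γ × δ) where
  size p := Sized.size p.1 + Sized.size p.2
  finite_size n := by
    refine (((Set.finite_Iic n).biUnion fun i _ => Sized.finite_size (γ := γ) i).prod
      ((Set.finite_Iic n).biUnion fun i _ => Sized.finite_size (γ := δ) i)).subset ?_
    rintro ⟨a, b⟩ h
    simp only [Set.mem_ofPred_eq] at h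
    simp only [Set.mem_prod, Set.mem_iUnion, Set.mem_Iic, Set.mem_ofPred_eq, exists_prop,
      exists_eq_right']
    omega

/-- Objects encoded injectively by standard words are finitely many in each length. -/
theorem finite_word {γ : Type} (f : γ → List ℕ) (hf : f.Injective) (hs : ∀ a, Standard (f a))
    (n : ℕ) : {a | (f a).length = n}.Finite := by
  refine Set.Finite.of_finite_image (f := f) ?_ hf.injOn
  refine (List.finite_toSet (List.range n).permutations).subset ?_
  rintro _ ⟨a, rfl, rfl⟩
  exact List.mem_permutations.2 (hs a)

instance : Sized AvTree where
  size T := T.word.length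
  finite_size := finite_word _ AvTree.word_injective AvTree.standard_word

instance : Sized OnceTree where
  size T := T.word.length
  finite_size := finite_word _ OnceTree.word_injective OnceTree.standard_word

section

variable {γ δ : Type} [Sized γ] [Sized δ]

theorem genFun_add (u v : γ → ℚ) : genFun (fun a => u a + v a) = genFun u + genFun v := by
  ext n
  simp [genFun, Finset.sum_add_distrib]

theorem genFun_mul (u : γ → ℚ) (v : δ → ℚ) :
    genFun (fun p : γ × δ => u p.1 * v p.2) = genFun u * genFun v := by
  ext n
  rw [coeff_mul, genFun, coeff_mk]
  rw [← Finset.sum_fiberwise_of_maps_to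
    (g := fun p : γ × δ => (Sized.size p.1, Sized.size p.2))
    (t := Finset.HasAntidiagonal.antidiagonal n)]
  · refine Finset.sum_congr rfl fun ij hij => ?_
    rw [genFun, genFun, coeff_mk, coeff_mk, Finset.sum_mul_sum, ← Finset.sum_product']
    refine Finset.sum_congr ?_ fun _ _ => rfl
    ext ⟨a, b⟩
    simp only [Finset.mem_filter, Set.Finite.mem_toFinset, Set.mem_ofPred_eq, Finset.mem_product,
      Prod.ext_iff, Finset.HasAntidiagonal.mem_antidiagonal] at hij ⊢
    constructor
    · exact fun h => h.2
    · rintro ⟨h1, h2⟩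
      refine ⟨?_, h1, h2⟩
      change Sized.size a + Sized.size b = n
      omega
  · rintro ⟨a, b⟩ h
    rw [Set.Finite.mem_toFinset] at h
    exact Finset.HasAntidiagonal.mem_antidiagonal.2 h

/-- A constructor that raises the size by `c` multiplies the generating function by `x ^ c`. -/
theorem genFun_of_injective (f : δ → γ) (hf : f.Injective) (c : ℕ)
    (hs : ∀ d, Sized.size (f d) = Sized.size d + c) (w : γ → ℚ)
    (hw : ∀ a, a ∉ Set.range f → w a = 0) :
    genFun w = X ^ c * genFun (fun d => w (f d)) := by
  ext n
  rw [coeff_X_pow_mul', genFun, genFun, coeff_mk, coeff_mk]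
  split_ifs with hc
  · symm
    refine Finset.sum_of_injOn f hf.injOn ?_ ?_ fun _ _ => rfl
    · intro d hd
      simp only [Set.Finite.coe_toFinset, Set.mem_ofPred_eq] at hd ⊢
      rw [hs]
      omega
    · intro a ha h
      refine hw a ?_
      rintro ⟨d, rfl⟩
      refine h ⟨d, ?_, rfl⟩
      simp only [Set.Finite.mem_toFinset, Set.Finite.coe_toFinset, Set.mem_ofPred_eq] at ha ⊢
      rw [hs] at ha
      omega
  · refine Finset.sum_eq_zero fun a ha => hw a ?_
    rintro ⟨d, rfl⟩
    simp only [Set.Finite.mem_toFinset, Set.mem_ofPred_eq] at ha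
    rw [hs] at ha
    omega

end

theorem genFun_avTree (w : AvTree → ℚ) :
    genFun w = C (w .nil) + X * genFun (fun p : AvTree × AvTree => w (.node p.1 p.2)) := by
  have h1 : genFun w = genFun (fun T : AvTree => T.casesOn (w .nil) fun _ _ => 0) +
      genFun (fun T : AvTree => T.casesOn 0 fun l r => w (.node l r)) := by
    rw [← genFun_add]
    congr 1
    ext (_ | ⟨l, r⟩) <;> simp
  rw [h1]
  congr 1
  · ext n
    rw [genFun, coeff_mk, coeff_C]
    split_ifs with hn
    · rw [Finset.sum_eq_single AvTree.nil]
      · rintro (_ | ⟨l, r⟩) - h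
        · exact absurd rfl h
        · rfl
      · intro h
        rw [Set.Finite.mem_toFinset] at h
        exact absurd hn.symm h
    · refine Finset.sum_eq_zero ?_
      rintro (_ | ⟨l, r⟩) h
      · rw [Set.Finite.mem_toFinset] at h
        exact absurd h.symm hn
      · rfl
  · rw [genFun_of_injective (fun p : AvTree × AvTree => AvTree.node p.1 p.2) _ 1 _ _ _, pow_one]
    · rintro ⟨a, b⟩ ⟨c, d⟩ h
      simpa using h
    · exact fun p => length_glue _ _
    · rintro (_ | ⟨l, r⟩) h
      · rfl
      · exact absurd ⟨(l, r), rfl⟩ h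

theorem genFun_onceTree (w : OnceTree → ℚ) :
    genFun w = X * genFun (fun p : OnceTree × AvTree => w (.left p.1 p.2)) +
      X * genFun (fun p : AvTree × OnceTree => w (.right p.1 p.2)) +
      X ^ 3 * genFun (fun p : AvTree × AvTree × AvTree => w (.cross p.1 p.2.1 p.2.2)) := by
  have h1 : genFun w =
      genFun (fun T : OnceTree => T.casesOn (fun o r => w (.left o r)) (fun _ _ => 0)
        (fun _ _ _ => 0)) +
      genFun (fun T : OnceTree => T.casesOn (fun _ _ => 0) (fun l o => w (.right l o))
        (fun _ _ _ => 0)) +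
      genFun (fun T : OnceTree => T.casesOn (fun _ _ => 0) (fun _ _ => 0)
        (fun l r₁ r₂ => w (.cross l r₁ r₂))) := by
    rw [← genFun_add, ← genFun_add]
    congr 1
    ext (⟨l, r⟩ | ⟨l, r⟩ | ⟨l, r₁, r₂⟩) <;> simp
  rw [h1]
  congr 1
  · congr 1
    · rw [genFun_of_injective (fun p : OnceTree × AvTree => OnceTree.left p.1 p.2) _ 1 _ _ _,
        pow_one]
      · rintro ⟨a, b⟩ ⟨c, d⟩ h
        simpa using h
      · exact fun p => length_glue _ _
      · rintro (⟨l, r⟩ | ⟨l, r⟩ | ⟨l, r₁, r₂⟩) h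
        · exact absurd ⟨(l, r), rfl⟩ h
        · rfl
        · rfl
    · rw [genFun_of_injective (fun p : AvTree × OnceTree => OnceTree.right p.1 p.2) _ 1 _ _ _,
        pow_one]
      · rintro ⟨a, b⟩ ⟨c, d⟩ h
        simpa using h
      · exact fun p => length_glue _ _
      · rintro (⟨l, r⟩ | ⟨l, r⟩ | ⟨l, r₁, r₂⟩) h
        · rfl
        · exact absurd ⟨(l, r), rfl⟩ h
        · rfl
  · rw [genFun_of_injective
      (fun p : AvTree × AvTree × AvTree => OnceTree.cross p.1 p.2.1 p.2.2) _ 3 _ _ _]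
    · rintro ⟨a, b, c⟩ ⟨a', b', c'⟩ h
      simpa using h
    · intro p
      have h1 := length_cross p.1.word (glue p.2.1.word p.2.2.word)
      rw [length_glue] at h1
      refine h1.trans ?_
      change _ = p.1.word.length + (p.2.1.word.length + p.2.2.word.length) + 3
      omega
    · rintro (⟨l, r⟩ | ⟨l, r⟩ | ⟨l, r₁, r₂⟩) h
      · rfl
      · rfl
      · exact absurd ⟨(l, r₁, r₂), rfl⟩ h

/-- The indicator of `a = r`. -/
def ind (a r : ℕ) : ℚ := if a = r then 1 else 0

/-- The generating function of the words without `1-3-2` at which the statistic `f` takes the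
value `r`. -/
noncomputable def avSeries (f : List ℕ → ℕ) (r : ℕ) : PowerSeries ℚ :=
  genFun fun T : AvTree => ind (f T.word) r

/-- The generating function of the words with exactly one `1-3-2` at which the statistic `f` takes
the value `r`. -/
noncomputable def onceSeries (f : List ℕ → ℕ) (r : ℕ) : PowerSeries ℚ :=
  genFun fun T : OnceTree => ind (f T.word) r

theorem avSeries_congr {f g : List ℕ → ℕ} {r s : ℕ} (h : ∀ l, f l = r ↔ g l = s) :
    avSeries f r = avSeries g s := by
  simp [avSeries, ind, h]

theorem onceSeries_congr {f g : List ℕ → ℕ} {r s : ℕ} (h : ∀ l, l ≠ [] → (f l = r ↔ g l = s)) :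
    onceSeries f r = onceSeries g s := by
  have h' : ∀ T : OnceTree, f T.word = r ↔ g T.word = s := fun T => h _ fun h0 =>
    T.once_word.not_avoids (h0 ▸ avoids_nil)
  simp [onceSeries, ind, h']

theorem ind_add_zero (a b : ℕ) : ind (a + b) 0 = ind a 0 * ind b 0 := by
  simp only [ind]
  split_ifs <;> first | omega | simp

theorem ind_add_one (a b : ℕ) : ind (a + b) 1 = ind a 0 * ind b 1 + ind a 1 * ind b 0 := by
  simp only [ind]
  split_ifs <;> first | omega | simp

section

variable {f g k h k' : List ℕ → ℕ}

theorem avSeries_zero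
    (hg : ∀ α β, Standard α → Standard β → f (glue α β) = g α + k β) :
    avSeries f 0 = C (ind (f []) 0) + X * (avSeries g 0 * avSeries k 0) := by
  rw [avSeries, genFun_avTree, avSeries, avSeries, ← genFun_mul]
  simp only [AvTree.word, hg _ _ (AvTree.standard_word _) (AvTree.standard_word _),
    ind_add_zero]

theorem avSeries_one
    (hg : ∀ α β, Standard α → Standard β → f (glue α β) = g α + k β) :
    avSeries f 1 = C (ind (f []) 1) +
      X * (avSeries g 0 * avSeries k 1 + avSeries g 1 * avSeries k 0) := by
  rw [avSeries, genFun_avTree, avSeries, avSeries, avSeries, avSeries, ← genFun_mul,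
    ← genFun_mul, ← genFun_add]
  simp only [AvTree.word, hg _ _ (AvTree.standard_word _) (AvTree.standard_word _),
    ind_add_one]

theorem X_mul_genFun_node (k : List ℕ → ℕ) (r : ℕ) :
    X * genFun (fun p : AvTree × AvTree =>
      ind (k (glue p.1.word p.2.word)) r) =
      avSeries k r - C (ind (k []) r) := by
  rw [avSeries, genFun_avTree]
  simp only [AvTree.word]
  ring

/-- A statistic that is additive on glued and on crossed words makes the generating functions
multiplicative. The right part of a crossed word is nonempty, so the contribution of the empty word
is subtracted there; this part has the size of its encoding tree and the crossed word two letters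
more than its parts, whence the factor `x ^ 2`. -/
theorem onceSeries_zero
    (hg : ∀ α β, Standard α → Standard β → f (glue α β) = g α + k β)
    (hc : ∀ α β, Standard α → Standard β → β ≠ [] → f (cross α β) = h α + k' β) :
    onceSeries f 0 = X * (onceSeries g 0 * avSeries k 0 + avSeries g 0 * onceSeries k 0) +
      X ^ 2 * (avSeries h 0 * (avSeries k' 0 - C (ind (k' []) 0))) := by
  have hc' : ∀ l r₁ r₂ : AvTree, f (cross l.word (glue r₁.word r₂.word)) =
      h l.word + k' (glue r₁.word r₂.word) := fun l r₁ r₂ =>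
    hc _ _ l.standard_word (AvTree.node r₁ r₂).standard_word (glue_ne_nil _ _)
  rw [onceSeries, genFun_onceTree, ← X_mul_genFun_node]
  simp only [OnceTree.word, hc', hg _ _ (AvTree.standard_word _) (OnceTree.standard_word _),
    hg _ _ (OnceTree.standard_word _) (AvTree.standard_word _), ind_add_zero]
  rw [genFun_mul (fun o : OnceTree => ind (g o.word) 0)
      (fun r : AvTree => ind (k r.word) 0),
    genFun_mul (fun l : AvTree => ind (g l.word) 0)
      (fun o : OnceTree => ind (k o.word) 0),
    genFun_mul (fun l : AvTree => ind (h l.word) 0)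
      (fun p : AvTree × AvTree => ind (k' (glue p.1.word p.2.word)) 0)]
  simp only [avSeries, onceSeries]
  ring

theorem onceSeries_one
    (hg : ∀ α β, Standard α → Standard β → f (glue α β) = g α + k β)
    (hc : ∀ α β, Standard α → Standard β → β ≠ [] → f (cross α β) = h α + k' β) :
    onceSeries f 1 = X * (onceSeries g 0 * avSeries k 1 + onceSeries g 1 * avSeries k 0 +
        avSeries g 0 * onceSeries k 1 + avSeries g 1 * onceSeries k 0) +
      X ^ 2 * (avSeries h 0 * (avSeries k' 1 - C (ind (k' []) 1)) +
        avSeries h 1 * (avSeries k' 0 - C (ind (k' []) 0))) := by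
  have hc' : ∀ l r₁ r₂ : AvTree, f (cross l.word (glue r₁.word r₂.word)) =
      h l.word + k' (glue r₁.word r₂.word) := fun l r₁ r₂ =>
    hc _ _ l.standard_word (AvTree.node r₁ r₂).standard_word (glue_ne_nil _ _)
  rw [onceSeries, genFun_onceTree, ← X_mul_genFun_node, ← X_mul_genFun_node]
  simp only [OnceTree.word, hc', hg _ _ (AvTree.standard_word _) (OnceTree.standard_word _),
    hg _ _ (OnceTree.standard_word _) (AvTree.standard_word _), ind_add_one]
  have h1 : ∀ i j, genFun (fun p : OnceTree × AvTree =>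
      ind (g p.1.word) i * ind (k p.2.word) j) = onceSeries g i * avSeries k j := fun i j =>
    genFun_mul (fun o : OnceTree => ind (g o.word) i)
      (fun r : AvTree => ind (k r.word) j)
  have h2 : ∀ i j, genFun (fun p : AvTree × OnceTree =>
      ind (g p.1.word) i * ind (k p.2.word) j) = avSeries g i * onceSeries k j := fun i j =>
    genFun_mul (fun l : AvTree => ind (g l.word) i)
      (fun o : OnceTree => ind (k o.word) j)
  have h3 : ∀ i j, genFun (fun p : AvTree × AvTree × AvTree =>
      ind (h p.1.word) i * ind (k' (glue p.2.1.word p.2.2.word)) j) =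
      avSeries h i * genFun (fun p : AvTree × AvTree =>
        ind (k' (glue p.1.word p.2.word)) j) := fun i j =>
    genFun_mul (fun l : AvTree => ind (h l.word) i)
      (fun p : AvTree × AvTree => ind (k' (glue p.1.word p.2.word)) j)
  rw [genFun_add, genFun_add, genFun_add, h1, h1, h2, h2, h3, h3]
  ring

end

/-! ### Counting occurrences of `12-3-⋯-k` and `21-3-⋯-k` -/

/-- The number of increasing subsequences of a word that have length `j` and letters greater
than `v`. -/
def inc : ℕ → ℕ → List ℕ → ℕ
  | 0, _, _ => 1
  | _ + 1, _, [] => 0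
  | j + 1, v, y :: l => inc (j + 1) v l + if v < y then inc j y l else 0

/-- The number of ways to choose in a word two adjacent letters `x`, `y` with `R x y` and an
increasing sequence of `j` letters to their right that exceed both. For `R = (<)` and `R = (>)`
these are the occurrences of `12-3-⋯-(j + 2)` and `21-3-⋯-(j + 2)`. -/
def occ (R : ℕ → ℕ → Prop) [DecidableRel R] (j : ℕ) : List ℕ → ℕ
  | [] => 0
  | [_] => 0
  | x :: y :: l => occ R j (y :: l) + if R x y then inc j (max x y) l else 0

/-- `0` for the empty word and `1` for every other word. -/
def nonNil : List ℕ → ℕ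
  | [] => 0
  | _ :: _ => 1

@[simp] theorem inc_zero (v : ℕ) (l : List ℕ) : inc 0 v l = 1 := by cases l <;> rfl

@[simp] theorem inc_succ_nil (j v : ℕ) : inc (j + 1) v [] = 0 := rfl

theorem inc_succ_cons (j v y : ℕ) (l : List ℕ) :
    inc (j + 1) v (y :: l) = inc (j + 1) v l + if v < y then inc j y l else 0 := rfl

@[simp] theorem nonNil_nil : nonNil [] = 0 := rfl

@[simp] theorem nonNil_cons (x : ℕ) (l : List ℕ) : nonNil (x :: l) = 1 := rfl

@[simp] theorem nonNil_map (f : ℕ → ℕ) (l : List ℕ) : nonNil (l.map f) = nonNil l := by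
  cases l <;> rfl

theorem nonNil_eq_one {l : List ℕ} (h : l ≠ []) : nonNil l = 1 := by
  cases l
  · exact absurd rfl h
  · rfl

theorem inc_map {f : ℕ → ℕ} (hf : StrictMono f) (j v : ℕ) (l : List ℕ) :
    inc j (f v) (l.map f) = inc j v l := by
  induction l generalizing j v with
  | nil => cases j <;> rfl
  | cons y l ih =>
    cases j with
    | zero => simp
    | succ j => rw [List.map_cons, inc_succ_cons, inc_succ_cons, ih, ih,
        if_congr hf.lt_iff_lt rfl rfl]

theorem inc_succ_eq_zero {j v : ℕ} {l : List ℕ} (h : ∀ w ∈ l, w ≤ v) : inc (j + 1) v l = 0 := by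
  induction l with
  | nil => rfl
  | cons y l ih =>
    rw [inc_succ_cons, ih fun w hw => h w (List.mem_cons_of_mem _ hw),
      if_neg (not_lt.2 (h y List.mem_cons_self))]

theorem inc_append_of_le {j v : ℕ} {u l : List ℕ} (h : ∀ w ∈ u, w ≤ v) :
    inc (j + 1) v (u ++ l) = inc (j + 1) v l := by
  induction u with
  | nil => rfl
  | cons y u ih =>
    rw [List.cons_append, inc_succ_cons, ih fun w hw => h w (List.mem_cons_of_mem _ hw),
      if_neg (not_lt.2 (h y List.mem_cons_self)), add_zero]

/-- If the letters after `α` other than the largest letter `m` are small, an increasing sequence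
lies in `α` or ends with `m`. -/
theorem inc_append {m : ℕ} {u β : List ℕ} (α : List ℕ) (j v : ℕ) (hv : v < m)
    (huv : ∀ w ∈ u ++ β, w < v) (hα : ∀ y ∈ α, y < m) (huα : ∀ y ∈ α, ∀ w ∈ u ++ β, w < y) :
    inc (j + 1) v (α ++ (u ++ m :: β)) = inc (j + 1) v α + inc j v α := by
  induction α generalizing j v with
  | nil =>
    rw [List.nil_append, inc_append_of_le fun w hw => (huv w (by simp [hw])).le, inc_succ_cons,
      if_pos hv, inc_succ_eq_zero fun w hw => (huv w (by simp [hw])).le, inc_succ_nil]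
    cases j with
    | zero => simp
    | succ j =>
      rw [inc_succ_eq_zero fun w hw => ((huv w (by simp [hw])).trans hv).le, inc_succ_nil]
  | cons y α ih =>
    have hy := hα y List.mem_cons_self
    have hα' : ∀ y ∈ α, y < m := fun w hw => hα w (List.mem_cons_of_mem _ hw)
    have huα' : ∀ y ∈ α, ∀ w ∈ u ++ β, w < y := fun w hw => huα w (List.mem_cons_of_mem _ hw)
    rw [List.cons_append, inc_succ_cons, ih j v hv huv hα' huα', inc_succ_cons]
    cases j with
    | zero => simp; omega
    | succ j =>
      rw [ih j y hy (huα y List.mem_cons_self) hα' huα', inc_succ_cons]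
      split_ifs <;> omega

theorem inc_anti {v w : ℕ} (h : v ≤ w) (j : ℕ) (l : List ℕ) : inc j w l ≤ inc j v l := by
  induction l with
  | nil => cases j <;> simp
  | cons y l ih =>
    cases j with
    | zero => simp
    | succ j =>
      rw [inc_succ_cons, inc_succ_cons]
      split_ifs <;> omega

theorem inc_succ_eq_zero_of_inc_eq_zero {j v : ℕ} {l : List ℕ} (h : inc j v l = 0) :
    inc (j + 1) v l = 0 := by
  induction l generalizing j v with
  | nil => rfl
  | cons y l ih =>
    cases j with
    | zero => simp at h
    | succ j =>
      rw [inc_succ_cons] at h ⊢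
      rw [ih (by omega)]
      split_ifs with hy
      · rw [if_pos hy] at h
        rw [ih (by omega)]
      · rfl

/-- Dropping the last or the last but one letter of a longer sequence gives two sequences. -/
theorem inc_eq_zero_of_inc_le_one {j v : ℕ} {l : List ℕ} (h : inc (j + 1) v l ≤ 1) :
    inc (j + 2) v l = 0 := by
  induction l with
  | nil => rfl
  | cons y l ih =>
    rw [inc_succ_cons] at h ⊢
    rw [ih (by omega)]
    split_ifs with hy
    · rw [if_pos hy] at h
      have h1 := inc_anti hy.le (j + 1) l
      have h2 := inc_succ_eq_zero_of_inc_eq_zero (j := j) (v := y) (l := l)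
      omega
    · rfl

section

variable {R : ℕ → ℕ → Prop} [DecidableRel R]

@[simp] theorem occ_nil (j : ℕ) : occ R j [] = 0 := rfl

@[simp] theorem occ_singleton (j x : ℕ) : occ R j [x] = 0 := rfl

theorem occ_cons_cons (j x y : ℕ) (l : List ℕ) :
    occ R j (x :: y :: l) = occ R j (y :: l) + if R x y then inc j (max x y) l else 0 := rfl

theorem occ_map {f : ℕ → ℕ} (hf : StrictMono f) (hR : ∀ x y, R (f x) (f y) ↔ R x y) (j : ℕ) :
    ∀ l : List ℕ, occ R j (l.map f) = occ R j l
  | [] => rfl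
  | [_] => rfl
  | x :: y :: l => by
    have ih := occ_map hf hR j (y :: l)
    rw [List.map_cons] at ih
    rw [List.map_cons, List.map_cons, occ_cons_cons, occ_cons_cons, ih, ← hf.monotone.map_max,
      inc_map hf, if_congr (hR x y) rfl rfl]

theorem occ_succ_eq_zero_of_occ_eq_zero {j : ℕ} :
    ∀ {l : List ℕ}, occ R j l = 0 → occ R (j + 1) l = 0
  | [], _ => rfl
  | [_], _ => rfl
  | x :: y :: l, h => by
    rw [occ_cons_cons] at h ⊢
    rw [occ_succ_eq_zero_of_occ_eq_zero (l := y :: l) (by omega)]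
    split_ifs with hx
    · rw [if_pos hx] at h
      rw [inc_succ_eq_zero_of_inc_eq_zero (by omega)]
    · rfl

theorem occ_eq_zero_of_occ_le_one {j : ℕ} :
    ∀ {l : List ℕ}, occ R (j + 1) l ≤ 1 → occ R (j + 2) l = 0
  | [], _ => rfl
  | [_], _ => rfl
  | x :: y :: l, h => by
    rw [occ_cons_cons] at h ⊢
    rw [occ_eq_zero_of_occ_le_one (l := y :: l) (by omega)]
    split_ifs with hx
    · rw [if_pos hx] at h
      rw [inc_eq_zero_of_inc_le_one (by omega)]
    · rfl

theorem occ_cons_of_lt {j m : ℕ} {β : List ℕ} (h : ∀ w ∈ β, w < m) :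
    occ R (j + 1) (m :: β) = occ R (j + 1) β := by
  rcases β with _ | ⟨b, β⟩
  · rfl
  · rw [occ_cons_cons, inc_succ_eq_zero, ite_self, add_zero]
    exact fun w hw => (h w (List.mem_cons_of_mem _ hw)).le.trans (le_max_left _ _)

/-- The occurrences in `α w`, where the letters of `w` other than the largest letter `m` are
smaller than those of `α`: those in `α`, those in `w`, those made of a shorter occurrence in `α`
and of `m`, and those that begin with the last letter of `α`, counted by `δ`. -/
theorem occ_append {m j δ : ℕ} {u β : List ℕ} (α : List ℕ)
    (hα : ∀ y ∈ α, y < m) (huα : ∀ y ∈ α, ∀ w ∈ u ++ β, w < y)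
    (hδ : ∀ x ∈ α, occ R (j + 1) (x :: (u ++ m :: β)) = occ R (j + 1) (u ++ m :: β) + δ) :
    occ R (j + 1) (α ++ (u ++ m :: β)) =
      occ R (j + 1) α + occ R j α + nonNil α * δ + occ R (j + 1) (u ++ m :: β) := by
  induction α with
  | nil => simp
  | cons x α ih =>
    have hα' : ∀ y ∈ α, y < m := fun w hw => hα w (List.mem_cons_of_mem _ hw)
    have huα' : ∀ y ∈ α, ∀ w ∈ u ++ β, w < y := fun w hw => huα w (List.mem_cons_of_mem _ hw)
    have ih := ih hα' huα' fun x hx => hδ x (List.mem_cons_of_mem _ hx)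
    rcases α with _ | ⟨y, α⟩
    · rw [List.singleton_append, hδ x List.mem_cons_self]
      simp [add_comm]
    · have hx := hα x List.mem_cons_self
      have hy := hα y (by simp)
      rw [List.cons_append, List.cons_append, occ_cons_cons, ← List.cons_append, ih,
        inc_append α j (max x y) (max_lt hx hy)
          (fun w hw => (huα x List.mem_cons_self w hw).trans_le (le_max_left _ _))
          (fun w hw => hα' w (List.mem_cons_of_mem _ hw))
          (fun w hw => huα' w (List.mem_cons_of_mem _ hw)), occ_cons_cons, occ_cons_cons]
      simp only [nonNil_cons]
      split_ifs <;> omega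

theorem occ_zero_append {y : ℕ} {p : Prop} [Decidable p] (w : List ℕ) (α : List ℕ)
    (h : ∀ x ∈ α, R x y ↔ p) :
    occ R 0 (α ++ y :: w) = occ R 0 α + (nonNil α * if p then 1 else 0) + occ R 0 (y :: w) := by
  induction α with
  | nil => simp
  | cons x α ih =>
    have ih := ih fun z hz => h z (List.mem_cons_of_mem _ hz)
    rcases α with _ | ⟨z, α⟩
    · rw [List.singleton_append, occ_cons_cons, if_congr (h x List.mem_cons_self) rfl rfl]
      simp [add_comm]
    · rw [List.cons_append, List.cons_append, occ_cons_cons, ← List.cons_append, ih, occ_cons_cons]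
      simp only [nonNil_cons, inc_zero]
      omega

end

section glue

variable {α β : List ℕ}

theorem Standard.map_add_lt (hα : Standard α) {y k : ℕ} (hy : y ∈ α.map (· + k)) :
    y < α.length + k := by
  obtain ⟨v, hv, rfl⟩ := List.mem_map.1 hy
  have := hα.mem_iff.1 hv
  omega

theorem le_of_mem_map_add {y k : ℕ} (hy : y ∈ α.map (· + k)) : k ≤ y := by
  obtain ⟨v, hv, rfl⟩ := List.mem_map.1 hy
  omega

theorem Standard.le_of_mem_map_bump (hβ : Standard β) {y : ℕ} (hy : y ∈ β.map (bump β.length)) :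
    y ≤ β.length := by
  obtain ⟨v, hv, rfl⟩ := List.mem_map.1 hy
  have := bump_lt (hβ.mem_iff.1 hv)
  omega

theorem occ_succ_glue {R : ℕ → ℕ → Prop} [DecidableRel R]
    (hR : ∀ f : ℕ → ℕ, StrictMono f → ∀ x y, R (f x) (f y) ↔ R x y) (j : ℕ)
    (hα : Standard α) (hβ : Standard β) :
    occ R (j + 1) (glue α β) = occ R (j + 1) α + occ R j α + occ R (j + 1) β := by
  have hβm : ∀ w ∈ β, w < α.length + β.length := fun w hw => by
    have := hβ.mem_iff.1 hw
    omega
  have h := occ_append (R := R) (j := j) (δ := 0) (u := []) (β := β) (m := α.length + β.length)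
    (α.map (· + β.length)) (fun y hy => hα.map_add_lt hy)
    (fun y hy w hw => (hβ.mem_iff.1 hw).trans_le (le_of_mem_map_add hy))
    (fun x hx => by
      rw [List.nil_append, occ_cons_cons, inc_succ_eq_zero, ite_self]
      exact fun w hw => (hβm w hw).le.trans (le_max_right _ _))
  rw [List.nil_append, occ_cons_of_lt hβm, occ_map (strictMono_add _) (hR _ (strictMono_add _)),
    occ_map (strictMono_add _) (hR _ (strictMono_add _))] at h
  rw [glue, h]
  simp

theorem occ_succ_cross {R : ℕ → ℕ → Prop} [DecidableRel R]
    (hR : ∀ f : ℕ → ℕ, StrictMono f → ∀ x y, R (f x) (f y) ↔ R x y) (j : ℕ)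
    (hα : Standard α) (hβ : Standard β) (h0 : β ≠ []) :
    occ R (j + 1) (cross α β) = occ R (j + 1) α + occ R j α +
      nonNil α * (if R 1 0 ∧ j = 0 then 1 else 0) + occ R (j + 1) β := by
  have hpos := List.length_pos_of_ne_nil h0
  have hβm : ∀ w ∈ β.map (bump β.length), w < α.length + β.length + 1 := fun w hw => by
    have := hβ.le_of_mem_map_bump hw
    omega
  have h := occ_append (R := R) (j := j) (δ := if R 1 0 ∧ j = 0 then 1 else 0)
    (u := [β.length - 1]) (β := β.map (bump β.length)) (m := α.length + β.length + 1)
    (α.map (· + (β.length + 1))) (fun y hy => hα.map_add_lt hy)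
    (fun y hy w hw => by
      have h1 := le_of_mem_map_add hy
      rcases List.mem_append.1 hw with hw | hw
      · rw [List.mem_singleton] at hw
        omega
      · have := hβ.le_of_mem_map_bump hw
        omega)
    (fun x hx => by
      have h1 := le_of_mem_map_add hx
      have h2 := hα.map_add_lt hx
      have hlt : β.length - 1 < x := by omega
      -- the relation `R` only depends on the relative order of its arguments
      have hRx : R x (β.length - 1) ↔ R 1 0 := by
        rw [← hR (fun v => if v = 0 then β.length - 1 else x + v - 1) ?_ 1 0]
        · simp
        · refine strictMono_nat_of_lt_succ fun n => ?_
          rcases n with _ | n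
          · simpa using hlt
          · simp
      rw [List.singleton_append, occ_cons_cons, if_congr hRx rfl rfl, max_eq_left hlt.le,
        inc_succ_cons, inc_succ_eq_zero (l := β.map _) fun w hw => ?_,
        if_pos (show x < α.length + β.length + 1 by omega), zero_add]
      · congr 1
        rcases j with _ | j
        · simp
        · rw [inc_succ_eq_zero fun w hw => (hβm w hw).le]
          simp
      · have := hβ.le_of_mem_map_bump hw
        omega)
  rw [nonNil_map, occ_map (strictMono_add _) (hR _ (strictMono_add _)),
    occ_map (strictMono_add _) (hR _ (strictMono_add _)), List.singleton_append, occ_cons_cons,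
    occ_cons_of_lt hβm, inc_succ_eq_zero fun w hw => (hβm w hw).le.trans (le_max_right _ _),
    ite_self, add_zero, occ_map (strictMono_bump _) (hR _ (strictMono_bump _))] at h
  exact h

theorem lt_strictMono_iff (f : ℕ → ℕ) (hf : StrictMono f) (x y : ℕ) : f x < f y ↔ x < y :=
  hf.lt_iff_lt

theorem gt_strictMono_iff (f : ℕ → ℕ) (hf : StrictMono f) (x y : ℕ) : f x > f y ↔ x > y :=
  hf.lt_iff_lt

theorem occ_lt_zero_cons_of_lt {m : ℕ} (h : ∀ w ∈ β, w < m) :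
    occ LT.lt 0 (m :: β) = occ LT.lt 0 β := by
  rcases β with _ | ⟨b, β⟩
  · rfl
  · rw [occ_cons_cons, if_neg (h b List.mem_cons_self).not_gt, add_zero]

theorem occ_gt_zero_cons_of_lt {m : ℕ} (h : ∀ w ∈ β, w < m) :
    occ GT.gt 0 (m :: β) = occ GT.gt 0 β + nonNil β := by
  rcases β with _ | ⟨b, β⟩
  · rfl
  · rw [occ_cons_cons, if_pos (h b List.mem_cons_self), inc_zero, nonNil_cons]

theorem occ_lt_zero_glue (hα : Standard α) (hβ : Standard β) :
    occ LT.lt 0 (glue α β) = occ LT.lt 0 α + nonNil α + occ LT.lt 0 β := by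
  rw [glue, occ_zero_append (p := True), occ_lt_zero_cons_of_lt,
    occ_map (strictMono_add _) (lt_strictMono_iff _ (strictMono_add _))]
  · simp
  · intro w hw
    have := hβ.mem_iff.1 hw
    omega
  · intro x hx
    exact iff_true_intro (hα.map_add_lt hx)

theorem occ_gt_zero_glue (hα : Standard α) (hβ : Standard β) :
    occ GT.gt 0 (glue α β) = occ GT.gt 0 α + (occ GT.gt 0 β + nonNil β) := by
  rw [glue, occ_zero_append (p := False), occ_gt_zero_cons_of_lt,
    occ_map (strictMono_add _) (gt_strictMono_iff _ (strictMono_add _))]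
  · simp
  · intro w hw
    have := hβ.mem_iff.1 hw
    omega
  · intro x hx
    exact iff_false_intro (hα.map_add_lt hx).not_gt

theorem occ_lt_zero_cross (hβ : Standard β) (h0 : β ≠ []) :
    occ LT.lt 0 (cross α β) = occ LT.lt 0 α + 1 + occ LT.lt 0 β := by
  have hpos := List.length_pos_of_ne_nil h0
  rw [cross, occ_zero_append (p := False), occ_cons_cons, occ_lt_zero_cons_of_lt,
    occ_map (strictMono_add _) (lt_strictMono_iff _ (strictMono_add _)),
    occ_map (strictMono_bump _) (lt_strictMono_iff _ (strictMono_bump _)),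
    if_pos (show β.length - 1 < α.length + β.length + 1 by omega)]
  · simp
    omega
  · intro w hw
    have := hβ.le_of_mem_map_bump hw
    omega
  · intro x hx
    have := le_of_mem_map_add hx
    exact iff_false_intro (by omega)

theorem occ_gt_zero_cross (hβ : Standard β) (h0 : β ≠ []) :
    occ GT.gt 0 (cross α β) = occ GT.gt 0 α + nonNil α + (occ GT.gt 0 β + 1) := by
  have hpos := List.length_pos_of_ne_nil h0
  rw [cross, occ_zero_append (p := True), occ_cons_cons, occ_gt_zero_cons_of_lt,
    occ_map (strictMono_add _) (gt_strictMono_iff _ (strictMono_add _)),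
    occ_map (strictMono_bump _) (gt_strictMono_iff _ (strictMono_bump _)),
    if_neg (show ¬ β.length - 1 > α.length + β.length + 1 by omega),
    nonNil_map, nonNil_map, nonNil_eq_one h0]
  · simp
  · intro w hw
    have := hβ.le_of_mem_map_bump hw
    omega
  · intro x hx
    have := le_of_mem_map_add hx
    exact iff_true_intro (by omega)

end glue

theorem inc_one_eq_zero_of_occ_eq_zero {y : ℕ} {l : List ℕ} (h : occ LT.lt 0 (y :: l) = 0) :
    inc 1 y l = 0 := by
  induction l generalizing y with
  | nil => rfl
  | cons z l ih =>
    rw [occ_cons_cons, inc_zero] at h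
    have hyz : ¬ y < z := fun hyz => by simp [hyz] at h
    rw [inc_succ_cons, if_neg hyz, add_zero]
    have h1 : inc 1 z l = 0 := ih (by omega)
    exact Nat.le_zero.1 ((inc_anti (not_lt.1 hyz) 1 l).trans_eq h1)

/-- A word with a single ascent has no occurrence of `12-3`. -/
theorem occ_lt_one_eq_zero_of_occ_le_one :
    ∀ {l : List ℕ}, occ LT.lt 0 l ≤ 1 → occ LT.lt 1 l = 0
  | [], _ => rfl
  | [_], _ => rfl
  | x :: y :: l, h => by
    rw [occ_cons_cons, inc_zero] at h
    rw [occ_cons_cons, occ_lt_one_eq_zero_of_occ_le_one (l := y :: l) (by omega)]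
    split_ifs with hx
    · rw [if_pos hx] at h
      rw [max_eq_right hx.le, inc_one_eq_zero_of_occ_eq_zero (by omega)]
    · rfl

/-! ### One-line notation -/

open GeneralizedPattern

/-- The one-line notation of a permutation. -/
def oneLine {n : ℕ} (π : Equiv.Perm (Fin n)) : List ℕ := List.ofFn fun i => (π i : ℕ)

@[simp] theorem length_oneLine {n : ℕ} (π : Equiv.Perm (Fin n)) : (oneLine π).length = n :=
  List.length_ofFn

theorem standard_oneLine {n : ℕ} (π : Equiv.Perm (Fin n)) : Standard (oneLine π) := by
  apply standard_of_nodup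
  · exact List.nodup_ofFn.2 (Fin.val_injective.comp π.injective)
  · intro v hv
    obtain ⟨i, rfl⟩ := List.mem_ofFn.1 hv
    rw [length_oneLine]
    exact (π i).2

theorem oneLine_injective {n : ℕ} : Function.Injective (oneLine (n := n)) := by
  intro π ρ h
  ext i
  exact congrFun (List.ofFn_injective h) i

theorem exists_oneLine_eq {l : List ℕ} (hl : Standard l) :
    ∃ π : Equiv.Perm (Fin l.length), oneLine π = l := by
  have hinj : Function.Injective
      (fun i : Fin l.length => (⟨l[i], hl.mem_iff.1 (List.getElem_mem _)⟩ : Fin l.length)) := by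
    intro i j h
    simp only [Fin.mk.injEq] at h
    exact Fin.ext ((hl.nodup.getElem_inj_iff).1 h)
  refine ⟨Equiv.ofBijective _ (Finite.injective_iff_bijective.1 hinj), ?_⟩
  simp [oneLine]

theorem ofFn_sublist_ofFn {γ : Type*} {k n : ℕ} {s : Fin k → γ} {g : Fin n → γ} :
    (List.ofFn s).Sublist (List.ofFn g) ↔ ∃ e : Fin k ↪o Fin n, ∀ i, s i = g (e i) := by
  rw [List.sublist_iff_exists_fin_orderEmbedding_get_eq]
  have hk : (List.ofFn s).length = k := List.length_ofFn
  have hn : (List.ofFn g).length = n := List.length_ofFn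
  constructor
  · rintro ⟨f, hf⟩
    refine ⟨((Fin.castOrderIso hk).symm.toOrderEmbedding.trans f).trans
      (Fin.castOrderIso hn).toOrderEmbedding, fun i => ?_⟩
    have := hf (Fin.cast hk.symm i)
    rw [List.get_ofFn, List.get_ofFn] at this
    exact this
  · rintro ⟨e, he⟩
    refine ⟨((Fin.castOrderIso hk).toOrderEmbedding.trans e).trans
      (Fin.castOrderIso hn).symm.toOrderEmbedding, fun i => ?_⟩
    rw [List.get_ofFn, List.get_ofFn]
    exact he (Fin.cast hk i)

theorem existsUnique_iff_of_injective {γ δ : Type*} {P : γ → Prop} {Q : δ → Prop} (f : γ → δ)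
    (hf : f.Injective) (hPQ : ∀ a, P a ↔ Q (f a)) (hr : ∀ b, Q b → ∃ a, f a = b) :
    (∃! a, P a) ↔ ∃! b, Q b := by
  constructor
  · rintro ⟨a, ha, hu⟩
    refine ⟨f a, (hPQ a).1 ha, fun b hb => ?_⟩
    obtain ⟨a', rfl⟩ := hr b hb
    rw [hu a' ((hPQ a').2 hb)]
  · rintro ⟨b, hb, hu⟩
    obtain ⟨a, rfl⟩ := hr b hb
    exact ⟨a, (hPQ a).2 hb, fun a' ha' => hf (hu _ ((hPQ a').1 ha'))⟩

theorem containedOnce_oneThreeTwo_iff {n : ℕ} (π : Equiv.Perm (Fin n)) :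
    oneThreeTwo.ContainedOnce π ↔ Once (oneLine π) := by
  refine existsUnique_iff_of_injective
    (fun e : Fin 3 ↪o Fin n => ((π (e 0) : ℕ), (π (e 1) : ℕ), (π (e 2) : ℕ))) ?_ ?_ ?_
  · intro e e' h
    simp only [Prod.mk.injEq, Fin.val_inj, EmbeddingLike.apply_eq_iff_eq] at h
    ext i
    fin_cases i <;> simp [h]
  · intro e
    have h1 : [(π (e 0) : ℕ), (π (e 1) : ℕ), (π (e 2) : ℕ)].Sublist (oneLine π) := by
      have := (ofFn_sublist_ofFn (s := fun i => (π (e i) : ℕ)) (g := fun i => (π i : ℕ))).2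
        ⟨e, fun i => rfl⟩
      simpa [oneLine, List.ofFn_succ] using this
    simp only [IsOccurrence, Is132, h1, oneThreeTwo, Fin.forall_fin_succ, true_and]
    simp
    omega
  · rintro ⟨a, b, c⟩ ⟨h, -⟩
    have h' : (List.ofFn ![a, b, c]).Sublist (List.ofFn fun i => (π i : ℕ)) := by
      simpa [oneLine, List.ofFn_succ] using h
    obtain ⟨e, he⟩ := ofFn_sublist_ofFn.1 h'
    exact ⟨e, by rw [← he, ← he, ← he]; rfl⟩

/-- The list `s` of letters and positions begins with two letters in the relation `R` at adjacent
positions, after which the letters increase and exceed those two. -/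
def IsGluedChain (R : ℕ → ℕ → Prop) : List (ℕ × ℕ) → Prop
  | [] => False
  | [_] => False
  | p :: q :: s => q.2 = p.2 + 1 ∧ R p.1 q.1 ∧ (max p.1 q.1 :: s.map Prod.fst).IsChain (· < ·)

open Classical in
/-- The recursive count agrees with the number of sublists that form such sequences. -/
theorem inc_eq_countP (j v p : ℕ) (l : List ℕ) :
    inc j v l = ((l.zipIdx p).sublistsLen j).countP
      fun s => (v :: s.map Prod.fst).IsChain (· < ·) := by
  induction l generalizing j v p with
  | nil => cases j <;> simp
  | cons y l ih =>
    cases j with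
    | zero => simp
    | succ j =>
      rw [List.zipIdx_cons, List.sublistsLen_succ_cons, List.countP_append, ← ih, List.countP_map,
        inc_succ_cons]
      congr 1
      split_ifs with h
      · rw [ih]
        refine List.countP_congr fun s _ => ?_
        simp [h]
      · symm
        rw [List.countP_eq_zero]
        simp [h]

open Classical in
theorem occ_eq_countP (R : ℕ → ℕ → Prop) [DecidableRel R] (j : ℕ) :
    ∀ (p : ℕ) (l : List ℕ), occ R j l = ((l.zipIdx p).sublistsLen (j + 2)).countP
      fun s => IsGluedChain R s
  | p, [] => by simp
  | p, [x] => by simp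
  | p, x :: y :: l => by
    rw [List.zipIdx_cons, List.sublistsLen_succ_cons, List.countP_append, ← occ_eq_countP R j,
      List.countP_map, occ_cons_cons, List.zipIdx_cons, List.sublistsLen_succ_cons,
      List.countP_append, List.countP_map]
    have h1 : ((l.zipIdx (p + 1 + 1)).sublistsLen (j + 1)).countP
        ((fun s => decide (IsGluedChain R s)) ∘ List.cons (x, p)) = 0 := by
      refine List.countP_eq_zero.2 fun s hs hc => ?_
      have hc' := of_decide_eq_true hc
      rcases s with _ | ⟨q, s⟩
      · exact hc'
      · have hq := List.le_snd_of_mem_zipIdx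
          ((List.mem_sublistsLen.1 hs).1.subset List.mem_cons_self)
        have hp : q.2 = p + 1 := hc'.1
        omega
    rw [h1, zero_add]
    congr 1
    split_ifs with h
    · rw [inc_eq_countP j _ (p + 1 + 1)]
      refine List.countP_congr fun s _ => ?_
      simp [IsGluedChain, h]
    · symm
      rw [List.countP_eq_zero]
      simp [IsGluedChain, h]

theorem countP_eq_one_iff {γ : Type*} {l : List γ} (hl : l.Nodup) (P : γ → Prop)
    [DecidablePred P] : l.countP (fun a => P a) = 1 ↔ ∃! a, a ∈ l ∧ P a := by
  rw [List.countP_eq_length_filter, List.length_eq_one_iff]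
  constructor
  · rintro ⟨a, h⟩
    have h' : ∀ b, (b ∈ l ∧ P b) ↔ b = a := fun b => by
      have := congrArg (b ∈ ·) h
      simpa using this
    exact ⟨a, (h' a).2 rfl, fun b hb => (h' b).1 hb⟩
  · rintro ⟨a, ha, hu⟩
    refine ⟨a, List.perm_singleton.1 ?_⟩
    rw [List.perm_ext_iff_of_nodup (hl.filter _) (List.nodup_singleton a)]
    intro b
    simp only [List.mem_filter, decide_eq_true_eq, List.mem_singleton]
    exact ⟨fun hb => hu b hb, fun hb => hb ▸ ha⟩

theorem zipIdx_oneLine {n : ℕ} (π : Equiv.Perm (Fin n)) :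
    (oneLine π).zipIdx = List.ofFn fun i => ((π i : ℕ), (i : ℕ)) := by
  apply List.ext_getElem <;> simp [oneLine]

/-- A pattern whose occurrences are the chains recognized by `IsGluedChain R` is counted
by `occ R`. -/
theorem containedOnce_iff_occ_eq_one {R : ℕ → ℕ → Prop} [DecidableRel R] {j n : ℕ}
    (τ : GeneralizedPattern (j + 2)) (π : Equiv.Perm (Fin n))
    (h : ∀ e : Fin (j + 2) ↪o Fin n, τ.IsOccurrence π e ↔
      IsGluedChain R (List.ofFn fun i => ((π (e i) : ℕ), (e i : ℕ)))) :
    τ.ContainedOnce π ↔ occ R j (oneLine π) = 1 := by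
  classical
  rw [occ_eq_countP R j 0, zipIdx_oneLine, countP_eq_one_iff]
  · refine existsUnique_iff_of_injective
      (fun e : Fin (j + 2) ↪o Fin n => List.ofFn fun i => ((π (e i) : ℕ), (e i : ℕ))) ?_ ?_ ?_
    · intro e e' h
      ext i
      exact congrArg Prod.snd (congrFun (List.ofFn_injective h) i)
    · intro e
      rw [h, List.mem_sublistsLen, List.length_ofFn]
      have hs : (List.ofFn fun i => ((π (e i) : ℕ), (e i : ℕ))).Sublist
          (List.ofFn fun i => ((π i : ℕ), (i : ℕ))) := ofFn_sublist_ofFn.2 ⟨e, fun i => rfl⟩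
      simp only [hs, true_and]
    · rintro s ⟨hs, -⟩
      obtain ⟨h1, h2⟩ := List.mem_sublistsLen.1 hs
      rw [← List.ofFn_get s] at h1
      obtain ⟨e, he⟩ := ofFn_sublist_ofFn.1 h1
      refine ⟨(Fin.castOrderIso h2.symm).toOrderEmbedding.trans e, ?_⟩
      apply List.ext_getElem
      · simp [h2]
      · intro i h3 h4
        rw [List.getElem_ofFn]
        exact (he ⟨i, h4⟩).symm
  · refine List.nodup_sublistsLen _ (List.nodup_ofFn.2 fun a b h => ?_)
    exact Fin.ext (congrArg Prod.snd h)

/-- Order isomorphism with a pattern whose letters, read in the order `σ`, are `1, …, k`. -/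
theorem forall_lt_iff_iff_isChain {k : ℕ} {g letter : Fin k → ℕ} (σ : Equiv.Perm (Fin k))
    (hσ : ∀ i, letter (σ i) = i + 1) :
    (∀ i j, g i < g j ↔ letter i < letter j) ↔
      (List.ofFn fun i => g (σ i)).IsChain (· < ·) := by
  rw [List.isChain_iff_pairwise, List.pairwise_ofFn]
  constructor
  · intro h i j hij
    rw [h, hσ, hσ]
    omega
  · intro h
    have hs : StrictMono fun i => g (σ i) := fun i j hij => h hij
    intro i j
    obtain ⟨i, rfl⟩ := σ.surjective i
    obtain ⟨j, rfl⟩ := σ.surjective j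
    rw [hσ, hσ, hs.lt_iff_lt]
    omega

theorem forall_glued_iff {j n : ℕ} (e : Fin (j + 2) ↪o Fin n) :
    (∀ a b : Fin (j + 2), (a : ℕ) = 0 → (b : ℕ) = (a : ℕ) + 1 → (e b : ℕ) = (e a : ℕ) + 1) ↔
      (e 1 : ℕ) = (e 0 : ℕ) + 1 := by
  constructor
  · intro h
    exact h 0 1 rfl rfl
  · intro h a b ha hb
    have h0 : a = 0 := Fin.ext ha
    have h1 : b = 1 := Fin.ext (by rw [hb, ha]; rfl)
    rw [h0, h1, h]

theorem containedOnce_oneTwo_iff {j n : ℕ} (π : Equiv.Perm (Fin n)) :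
    (oneTwo (j + 2)).ContainedOnce π ↔ occ LT.lt j (oneLine π) = 1 := by
  refine containedOnce_iff_occ_eq_one _ π fun e => ?_
  have h := forall_lt_iff_iff_isChain (g := fun i => (π (e i) : ℕ))
    (letter := (oneTwo (j + 2)).letter) 1 (fun i => rfl)
  simp only [Equiv.Perm.one_apply] at h
  rw [IsOccurrence, List.ofFn_succ, List.ofFn_succ, IsGluedChain, List.map_ofFn, and_comm]
  refine and_congr (forall_glued_iff e) ?_
  simp only [Fin.lt_def]
  rw [h, List.ofFn_succ, List.ofFn_succ, List.isChain_cons_cons]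
  refine and_congr_right fun hlt => ?_
  rw [max_eq_right]
  · rfl
  · exact hlt.le

theorem containedOnce_twoOne_iff {j n : ℕ} (π : Equiv.Perm (Fin n)) :
    (twoOne (j + 2)).ContainedOnce π ↔ occ GT.gt j (oneLine π) = 1 := by
  refine containedOnce_iff_occ_eq_one _ π fun e => ?_
  have hswap : ∀ i : Fin j, Equiv.swap (0 : Fin (j + 2)) 1 i.succ.succ = i.succ.succ := fun i =>
    Equiv.swap_apply_of_ne_of_ne (by simp [Fin.ext_iff]) (by simp [Fin.ext_iff])
  have h := forall_lt_iff_iff_isChain (g := fun i => (π (e i) : ℕ))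
    (letter := (twoOne (j + 2)).letter) (Equiv.swap 0 1) (by
      refine Fin.cases ?_ (Fin.cases ?_ fun i => ?_)
      · simp [twoOne]
      · simp [twoOne]
      · rw [hswap]
        simp [twoOne])
  rw [IsOccurrence, List.ofFn_succ, List.ofFn_succ, IsGluedChain, List.map_ofFn, and_comm]
  refine and_congr (forall_glued_iff e) ?_
  simp only [Fin.lt_def]
  rw [h, List.ofFn_succ, List.ofFn_succ, List.isChain_cons_cons]
  simp only [hswap, Fin.succ_zero_eq_one, Equiv.swap_apply_left, Equiv.swap_apply_right]
  refine and_congr_right fun hlt => ?_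
  rw [max_eq_left]
  · rfl
  · exact hlt.le

/-- The series `Φ` counts the words with exactly one `1-3-2` and one occurrence of the pattern. -/
theorem phi_eq_onceSeries {k : ℕ} (τ : GeneralizedPattern k) (f : List ℕ → ℕ)
    (h : ∀ {n : ℕ} (π : Equiv.Perm (Fin n)), τ.ContainedOnce π ↔ f (oneLine π) = 1) :
    Phi τ = onceSeries f 1 := by
  ext n
  rw [Phi, onceSeries, genFun, PowerSeries.coeff_mk, PowerSeries.coeff_mk]
  simp only [ind, Finset.sum_boole, containedOnce_oneThreeTwo_iff, h]
  congr 1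
  rw [← Set.ncard_coe_finset, ← Set.ncard_image_of_injective _ OnceTree.word_injective]
  change Nat.card {π : Equiv.Perm (Fin n) | Once (oneLine π) ∧ f (oneLine π) = 1} = _
  rw [Nat.card_coe_set_eq, ← Set.ncard_image_of_injective _ oneLine_injective]
  congr 1
  ext l
  simp only [Set.mem_image, Finset.coe_filter, Set.mem_ofPred_eq, Set.Finite.mem_toFinset]
  constructor
  · rintro ⟨π, ⟨h1, h2⟩, rfl⟩
    obtain ⟨T, hT⟩ := exists_onceTree_word_eq (standard_oneLine π) h1
    exact ⟨T, ⟨(congrArg List.length hT).trans (length_oneLine π), hT ▸ h2⟩, hT⟩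
  · rintro ⟨T, ⟨h1, h2⟩, rfl⟩
    obtain ⟨π, hπ⟩ := exists_oneLine_eq T.standard_word
    have h1 : T.word.length = n := h1
    subst h1
    exact ⟨π, ⟨hπ.symm ▸ T.once_word, hπ.symm ▸ h2⟩, hπ⟩

/-! ### Recurrences for the generating functions -/

/-- The linear system satisfied by the generating functions `A₀`, `A₁` of the words without `1-3-2`
and `B₀`, `B₁` of the words with one `1-3-2` that have no or one occurrence of a pattern with `k`
letters. The series `a₀`, `a₁`, `b₀`, `b₁` count words by what they contribute when they stand to
the left of the largest letter of a glued word, and `c₀`, `c₁` do so for crossed words. -/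
structure Recurrence {F : Type*} [CommRing F] (x a₀ a₁ b₀ b₁ c₀ c₁ A₀ A₁ B₀ B₁ : F) : Prop where
  A_zero : A₀ = 1 + x * (a₀ * A₀)
  A_one : A₁ = x * (a₀ * A₁ + a₁ * A₀)
  B_zero : B₀ = x * (b₀ * A₀ + a₀ * B₀) + x ^ 2 * (c₀ * (A₀ - 1))
  B_one : B₁ = x * (b₀ * A₁ + b₁ * A₀ + a₀ * B₁ + a₁ * B₀) + x ^ 2 * (c₀ * A₁ + c₁ * (A₀ - 1))

theorem Recurrence.map {F G : Type*} [CommRing F] [CommRing G] (φ : F →+* G)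
    {x a₀ a₁ b₀ b₁ c₀ c₁ A₀ A₁ B₀ B₁ : F} (h : Recurrence x a₀ a₁ b₀ b₁ c₀ c₁ A₀ A₁ B₀ B₁) :
    Recurrence (φ x) (φ a₀) (φ a₁) (φ b₀) (φ b₁) (φ c₀) (φ c₁) (φ A₀) (φ A₁) (φ B₀) (φ B₁) where
  A_zero := by simpa using congrArg φ h.A_zero
  A_one := by simpa using congrArg φ h.A_one
  B_zero := by simpa using congrArg φ h.B_zero
  B_one := by simpa using congrArg φ h.B_one

theorem recurrence_of_glue {f g h : List ℕ → ℕ} (h0 : f [] = 0)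
    (hg : ∀ α β, Standard α → Standard β → f (glue α β) = g α + f β)
    (hc : ∀ α β, Standard α → Standard β → β ≠ [] → f (cross α β) = h α + f β) :
    Recurrence X (avSeries g 0) (avSeries g 1) (onceSeries g 0) (onceSeries g 1)
      (avSeries h 0) (avSeries h 1) (avSeries f 0) (avSeries f 1) (onceSeries f 0)
      (onceSeries f 1) where
  A_zero := by simpa [ind, h0] using avSeries_zero hg
  A_one := by simpa [ind, h0] using avSeries_one hg
  B_zero := by simpa [ind, h0] using onceSeries_zero hg hc
  B_one := by simpa [ind, h0] using onceSeries_one hg hc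

theorem genFun_zero {γ : Type} [Sized γ] : genFun (fun _ : γ => 0) = 0 := by
  ext n
  simp [genFun]

theorem avSeries_eq_zero {f : List ℕ → ℕ} {r : ℕ} (h : ∀ l, f l ≠ r) : avSeries f r = 0 := by
  simp [avSeries, ind, h, genFun_zero]

theorem onceSeries_eq_zero {f : List ℕ → ℕ} {r : ℕ} (h : ∀ l, l ≠ [] → f l ≠ r) :
    onceSeries f r = 0 := by
  have h' : ∀ T : OnceTree, f T.word ≠ r := fun T => h _ fun h0 =>
    T.once_word.not_avoids (h0 ▸ avoids_nil)
  simp [onceSeries, ind, h', genFun_zero]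

theorem nonNil_pos {l : List ℕ} (h : l ≠ []) : 0 < nonNil l := by
  rw [nonNil_eq_one h]
  exact one_pos

theorem avSeries_nonNil : avSeries nonNil 0 = 1 := by
  have h : avSeries (fun _ => 1) 0 = 0 := avSeries_eq_zero fun l => one_ne_zero
  rw [avSeries_zero (g := fun _ => 1) (k := fun _ => 0)]
  · simp [h, ind]
  · exact fun α β _ _ => nonNil_eq_one (glue_ne_nil _ _)

theorem avSeries_add_nonNil_zero {f : List ℕ → ℕ} (h0 : f [] = 0) :
    avSeries (fun l => f l + nonNil l) 0 = 1 := by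
  rw [← avSeries_nonNil]
  refine avSeries_congr fun l => ?_
  cases l <;> simp [h0]

theorem avSeries_add_nonNil_one {f : List ℕ → ℕ} (h0 : f [] = 0) :
    avSeries (fun l => f l + nonNil l) 1 = avSeries f 0 - 1 := by
  rw [eq_sub_iff_add_eq', ← avSeries_nonNil, avSeries, avSeries, avSeries, ← genFun_add]
  congr 1
  ext T
  simp only [ind]
  rcases T.word with _ | ⟨x, l⟩ <;> simp [h0]

theorem onceSeries_add_nonNil_zero (f : List ℕ → ℕ) :
    onceSeries (fun l => f l + nonNil l) 0 = 0 :=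
  onceSeries_eq_zero fun l hl => by
    have := nonNil_pos hl
    omega

theorem onceSeries_add_nonNil_one (f : List ℕ → ℕ) :
    onceSeries (fun l => f l + nonNil l) 1 = onceSeries f 0 :=
  onceSeries_congr fun l hl => by
    rw [nonNil_eq_one hl]
    omega

/-- The recurrence from `k` to `k + 1` letters, valid when a word with at most one occurrence of
the shorter pattern has none of the longer one. -/
theorem recurrence_occ_succ {R : ℕ → ℕ → Prop} [DecidableRel R]
    (hR : ∀ f : ℕ → ℕ, StrictMono f → ∀ x y, R (f x) (f y) ↔ R x y) (j : ℕ)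
    (hj : ¬ (R 1 0 ∧ j = 0)) (hle : ∀ l, occ R j l ≤ 1 → occ R (j + 1) l = 0) :
    Recurrence X (avSeries (occ R j) 0) (avSeries (occ R j) 1)
      (onceSeries (occ R j) 0) (onceSeries (occ R j) 1)
      (avSeries (occ R j) 0) (avSeries (occ R j) 1)
      (avSeries (occ R (j + 1)) 0) (avSeries (occ R (j + 1)) 1)
      (onceSeries (occ R (j + 1)) 0) (onceSeries (occ R (j + 1)) 1) := by
  have h := recurrence_of_glue (f := occ R (j + 1)) (g := fun l => occ R (j + 1) l + occ R j l)
    (h := fun l => occ R (j + 1) l + occ R j l) rfl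
    (fun α β hα hβ => occ_succ_glue hR j hα hβ)
    (fun α β hα hβ h0 => by rw [occ_succ_cross hR j hα hβ h0, if_neg hj, mul_zero, add_zero])
  have e0 : ∀ l, occ R (j + 1) l + occ R j l = 0 ↔ occ R j l = 0 := fun l => by
    have := hle l
    omega
  have e1 : ∀ l, occ R (j + 1) l + occ R j l = 1 ↔ occ R j l = 1 := fun l => by
    have h1 := hle l
    have h2 := occ_succ_eq_zero_of_occ_eq_zero (R := R) (j := j) (l := l)
    omega
  rwa [avSeries_congr e0, avSeries_congr e1, onceSeries_congr fun l _ => e0 l,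
    onceSeries_congr fun l _ => e1 l] at h

/-- The starting recurrence for `12`: in a glued word the largest letter adds an ascent when the left
part is nonempty, in a crossed word it always does. -/
theorem recurrence_occ_lt_zero :
    Recurrence X 1 (avSeries (occ LT.lt 0) 0 - 1) 0 (onceSeries (occ LT.lt 0) 0)
      0 (avSeries (occ LT.lt 0) 0)
      (avSeries (occ LT.lt 0) 0) (avSeries (occ LT.lt 0) 1)
      (onceSeries (occ LT.lt 0) 0) (onceSeries (occ LT.lt 0) 1) := by
  have h := recurrence_of_glue (f := occ LT.lt 0) (g := fun l => occ LT.lt 0 l + nonNil l)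
    (h := fun l => occ LT.lt 0 l + 1) rfl (fun α β hα hβ => occ_lt_zero_glue hα hβ)
    (fun α β hα hβ h0 => occ_lt_zero_cross hβ h0)
  rwa [avSeries_add_nonNil_zero rfl, avSeries_add_nonNil_one rfl, onceSeries_add_nonNil_zero,
    onceSeries_add_nonNil_one, avSeries_eq_zero (r := 0) fun l => Nat.succ_ne_zero _,
    avSeries_congr (f := fun l => occ LT.lt 0 l + 1) (r := 1) (g := occ LT.lt 0) (s := 0)
      fun l => by omega] at h

/-- The number of descents plus the number of occurrences of `21-3`. It controls the part of a
word to the left of its largest letter when occurrences of `21-3` are counted. -/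
def desc (l : List ℕ) : ℕ := occ GT.gt 1 l + occ GT.gt 0 l

theorem desc_nil : desc [] = 0 := rfl

/-- The recurrence for `21-3`. In a crossed word a nonempty left part is followed by a descent,
which together with the largest letter is an occurrence of `21-3`. -/
theorem recurrence_occ_gt_one :
    Recurrence X (avSeries desc 0) (avSeries desc 1) (onceSeries desc 0) (onceSeries desc 1)
      1 (avSeries desc 0 - 1)
      (avSeries (occ GT.gt 1) 0) (avSeries (occ GT.gt 1) 1)
      (onceSeries (occ GT.gt 1) 0) (onceSeries (occ GT.gt 1) 1) := by
  have h := recurrence_of_glue (f := occ GT.gt 1) (g := desc)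
    (h := fun l => desc l + nonNil l) rfl
    (fun α β hα hβ => occ_succ_glue gt_strictMono_iff 0 hα hβ)
    (fun α β hα hβ h0 => by
      rw [occ_succ_cross gt_strictMono_iff 0 hα hβ h0, if_pos ⟨one_pos, rfl⟩, mul_one]
      rfl)
  rwa [avSeries_add_nonNil_zero desc_nil, avSeries_add_nonNil_one desc_nil] at h

theorem desc_glue {α β : List ℕ} (hα : Standard α) (hβ : Standard β) :
    desc (glue α β) = occ GT.gt 1 α + 2 * occ GT.gt 0 α + (desc β + nonNil β) := by
  simp only [desc]
  rw [occ_succ_glue gt_strictMono_iff 0 hα hβ, occ_gt_zero_glue hα hβ, zero_add]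
  omega

theorem desc_cross {α β : List ℕ} (hα : Standard α) (hβ : Standard β) (h0 : β ≠ []) :
    desc (cross α β) =
      occ GT.gt 1 α + 2 * occ GT.gt 0 α + 2 * nonNil α + (desc β + 1) := by
  simp only [desc]
  rw [occ_succ_cross gt_strictMono_iff 0 hα hβ h0, if_pos ⟨one_pos, rfl⟩,
    occ_gt_zero_cross hβ h0, zero_add]
  omega

theorem two_mul_desc_eq_zero_iff (l : List ℕ) :
    occ GT.gt 1 l + 2 * occ GT.gt 0 l = 0 ↔ desc l = 0 := by
  rw [desc]
  omega

/-- A word without descents has no occurrence of `21-3`. -/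
theorem two_mul_desc_ne_one (l : List ℕ) : occ GT.gt 1 l + 2 * occ GT.gt 0 l ≠ 1 := by
  have : occ GT.gt 0 l = 0 → occ GT.gt 1 l = 0 := occ_succ_eq_zero_of_occ_eq_zero
  omega

theorem avSeries_desc_zero : avSeries desc 0 = 1 + X * avSeries desc 0 := by
  conv_lhs => rw [avSeries_zero fun α β hα hβ => desc_glue hα hβ]
  rw [avSeries_congr two_mul_desc_eq_zero_iff, avSeries_add_nonNil_zero desc_nil]
  simp [ind, desc_nil]

theorem avSeries_desc_one :
    avSeries desc 1 = X * (avSeries desc 0 * (avSeries desc 0 - 1)) := by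
  rw [avSeries_one fun α β hα hβ => desc_glue hα hβ, avSeries_congr two_mul_desc_eq_zero_iff,
    avSeries_add_nonNil_one desc_nil, avSeries_eq_zero (r := 1) two_mul_desc_ne_one]
  simp [ind, desc_nil]

theorem avSeries_two_mul_nonNil_zero :
    avSeries (fun l => occ GT.gt 1 l + 2 * occ GT.gt 0 l + 2 * nonNil l) 0 = 1 := by
  rw [← avSeries_nonNil]
  refine avSeries_congr fun l => ?_
  cases l <;> simp

theorem onceSeries_desc_zero : onceSeries desc 0 = 0 := by
  have h := onceSeries_zero (fun α β hα hβ => desc_glue hα hβ)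
    (h := fun l => occ GT.gt 1 l + 2 * occ GT.gt 0 l + 2 * nonNil l) (k' := fun l => desc l + 1)
    (fun α β hα hβ h0 => desc_cross hα hβ h0)
  rw [onceSeries_congr fun l _ => two_mul_desc_eq_zero_iff l,
    avSeries_add_nonNil_zero desc_nil, onceSeries_add_nonNil_zero,
    avSeries_eq_zero (f := fun l => desc l + 1) (r := 0) fun l => Nat.succ_ne_zero _] at h
  have h1 : (1 - X) * onceSeries desc 0 = 0 := by
    have : ind (desc [] + 1) 0 = 0 := rfl
    rw [this, map_zero] at h
    linear_combination h
  refine (mul_eq_zero.1 h1).resolve_left fun h2 => ?_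
  have := congrArg constantCoeff h2
  simp at this

theorem onceSeries_desc_one : onceSeries desc 1 = X ^ 2 * (avSeries desc 0 - 1) := by
  rw [onceSeries_one (fun α β hα hβ => desc_glue hα hβ)
    (h := fun l => occ GT.gt 1 l + 2 * occ GT.gt 0 l + 2 * nonNil l) (k' := fun l => desc l + 1)
    (fun α β hα hβ h0 => desc_cross hα hβ h0),
    onceSeries_congr fun l _ => two_mul_desc_eq_zero_iff l, onceSeries_desc_zero,
    onceSeries_eq_zero fun l _ => two_mul_desc_ne_one l, onceSeries_add_nonNil_one,
    onceSeries_desc_zero, onceSeries_add_nonNil_zero, avSeries_two_mul_nonNil_zero,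
    avSeries_eq_zero (f := fun l => desc l + 1) (r := 0) fun l => Nat.succ_ne_zero _,
    avSeries_congr (f := fun l => desc l + 1) (r := 1) (g := desc) (s := 0) fun l => by omega]
  have h1 : ind (desc [] + 1) 0 = 0 := rfl
  have h2 : ind (desc [] + 1) 1 = 1 := rfl
  rw [h1, h2, map_zero, map_one]
  ring

/-! ### Solving the recurrences by Chebyshev polynomials -/

section Field

variable {F : Type*} [Field F]

/-- One step of the solution, where `w`, `u`, `v` are three consecutive values of `U`. -/
theorem Recurrence.step {s u v w S c d β A₀ A₁ B₀ B₁ : F} (hs : s ≠ 0) (hu : u ≠ 0) (hv : v ≠ 0)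
    (huv : s * v = u - s * w) (hw : w * v = u ^ 2 - 1)
    (h : Recurrence (s ^ 2) (w / (s * u)) (c / u ^ 2) (s ^ 2 * (S - d) / u ^ 2) (β / u ^ 2)
      (w / (s * u)) (c / u ^ 2) A₀ A₁ B₀ B₁) :
    A₀ = u / (s * v) ∧ A₁ = c / v ^ 2 ∧ B₀ = s ^ 2 * (S + w ^ 2 - d) / v ^ 2 ∧
      B₁ = (β + 2 * c * s ^ 3 * (S + w ^ 2 + u ^ 2 - 1 - d) / (u * v)) / v ^ 2 := by
  have key : 1 - s ^ 2 * (w / (s * u)) = s * v / u := by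
    field_simp
    linear_combination -huv
  have solve : ∀ Z Y : F, Z = s ^ 2 * (w / (s * u)) * Z + Y → Z = Y * u / (s * v) := by
    intro Z Y hZ
    have h1 : Z * (s * v / u) = Y := by
      rw [← key]
      linear_combination hZ
    rw [← h1]
    field_simp
  have hA₀ : A₀ = u / (s * v) := by
    rw [solve A₀ 1 (by linear_combination h.A_zero), one_mul]
  have hA₁ : A₁ = c / v ^ 2 := by
    rw [solve A₁ (s ^ 2 * (c / u ^ 2) * A₀) (by linear_combination h.A_one), hA₀]
    field_simp
  have hA : A₀ - 1 = w / v := by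
    rw [hA₀]
    field_simp
    linear_combination -huv
  have hB₀ : B₀ = s ^ 2 * (S + w ^ 2 - d) / v ^ 2 := by
    rw [solve B₀ (s ^ 2 * (s ^ 2 * (S - d) / u ^ 2 * A₀) + (s ^ 2) ^ 2 * (w / (s * u) * (A₀ - 1)))
      (by linear_combination h.B_zero), hA, hA₀]
    field_simp
    ring
  refine ⟨hA₀, hA₁, hB₀, ?_⟩
  rw [solve B₁ (s ^ 2 * (s ^ 2 * (S - d) / u ^ 2 * A₁ + β / u ^ 2 * A₀ + c / u ^ 2 * B₀) +
    (s ^ 2) ^ 2 * (w / (s * u) * A₁ + c / u ^ 2 * (A₀ - 1)))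
    (by linear_combination h.B_one), hA, hA₀, hA₁, hB₀]
  field_simp
  linear_combination (-c * s ^ 2 * w) * huv + 2 * c * s ^ 3 * hw

/-- The solution for the pattern `12`, where `u` is the value of `U₂`. -/
theorem Recurrence.base_lt {s u A₀ A₁ B₀ B₁ : F} (hs : s ≠ 0) (hu : u ≠ 0)
    (hsu : s ^ 2 * u = 1 - s ^ 2) (h : Recurrence (s ^ 2) 1 (A₀ - 1) 0 B₀ 0 A₀ A₀ A₁ B₀ B₁) :
    A₀ = s⁻¹ / (s * u) ∧ A₁ = 1 / (s ^ 2 * u) / u ^ 2 ∧ B₀ = 0 ∧ B₁ = 1 / u / u ^ 2 := by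
  have solve : ∀ Z Y : F, Z = s ^ 2 * Z + Y → Z = Y / (s ^ 2 * u) := by
    intro Z Y hZ
    rw [eq_div_iff (by positivity), hsu]
    linear_combination hZ
  have hA₀ : A₀ = 1 / (s ^ 2 * u) := solve _ _ (by linear_combination h.A_zero)
  have hB₀ : B₀ = 0 := by
    rw [solve B₀ 0 (by linear_combination h.B_zero), zero_div]
  have hA : A₀ - 1 = 1 / u := by
    rw [hA₀]
    field_simp
    linear_combination -hsu
  refine ⟨?_, ?_, hB₀, ?_⟩
  · rw [hA₀]
    field_simp
  · rw [solve A₁ (s ^ 2 * ((A₀ - 1) * A₀)) (by linear_combination h.A_one), hA, hA₀]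
    field_simp
  · rw [solve B₁ ((s ^ 2) ^ 2 * (A₀ * (A₀ - 1)))
      (by linear_combination h.B_one + s ^ 2 * (2 * A₀ - 1) * hB₀), hA, hA₀]
    field_simp

/-- The solution for the pattern `21-3`, where `u` and `v` are the values of `U₂` and `U₃`. -/
theorem Recurrence.base_gt {s u v D A₀ A₁ B₀ B₁ : F} (hs : s ≠ 0) (hu : u ≠ 0) (hv : v ≠ 0)
    (hsu : s ^ 2 * u = 1 - s ^ 2) (huv : s * v = u - 1) (hD : D = 1 + s ^ 2 * D)
    (h : Recurrence (s ^ 2) D (s ^ 2 * (D * (D - 1))) 0 ((s ^ 2) ^ 2 * (D - 1)) 1 (D - 1)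
      A₀ A₁ B₀ B₁) :
    A₀ = u / (s * v) ∧ A₁ = 1 / v ^ 2 ∧ B₀ = s ^ 2 * (s⁻¹ ^ 2 - 1) / v ^ 2 ∧
      B₁ = 2 * s ^ 3 * (u ^ 2 / v) / v ^ 2 := by
  have hD' : D = 1 / (s ^ 2 * u) := by
    rw [eq_div_iff (by positivity), hsu]
    linear_combination hD
  have hD1 : D - 1 = 1 / u := by
    rw [hD']
    field_simp
    linear_combination -hsu
  have key : 1 - s ^ 2 * D = s * v / u := by
    rw [hD', huv]
    field_simp
  have solve : ∀ Z Y : F, Z = s ^ 2 * D * Z + Y → Z = Y * u / (s * v) := by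
    intro Z Y hZ
    have h1 : Z * (s * v / u) = Y := by
      rw [← key]
      linear_combination hZ
    rw [← h1]
    field_simp
  have hA₀ : A₀ = u / (s * v) := by
    rw [solve A₀ 1 (by linear_combination h.A_zero), one_mul]
  have hA₁ : A₁ = 1 / v ^ 2 := by
    rw [solve A₁ (s ^ 2 * (s ^ 2 * (D * (D - 1))) * A₀) (by linear_combination h.A_one), hD1, hD',
      hA₀]
    field_simp
  have hA : A₀ - 1 = 1 / (s * v) := by
    rw [hA₀]
    field_simp
    linear_combination -huv
  have hB₀ : B₀ = s ^ 2 * (s⁻¹ ^ 2 - 1) / v ^ 2 := by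
    rw [solve B₀ ((s ^ 2) ^ 2 * (A₀ - 1)) (by linear_combination h.B_zero), hA]
    field_simp
    linear_combination hsu
  refine ⟨hA₀, hA₁, hB₀, ?_⟩
  rw [solve B₁ (s ^ 2 * ((s ^ 2) ^ 2 * (D - 1) * A₀ + s ^ 2 * (D * (D - 1)) * B₀) +
    (s ^ 2) ^ 2 * (A₁ + (D - 1) * (A₀ - 1)))
    (by linear_combination h.B_one), hA, hD1, hD', hA₀, hA₁, hB₀]
  field_simp
  linear_combination (s ^ 2 * u ^ 2 + u) * huv - hsu + u * (1 - u) * hsu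

/-- The generating functions `A₀`, `A₁`, `B₀`, `B₁` for a pattern with `j + 2` letters, in terms of
the values `U i` of the Chebyshev polynomials and of `s = √x`. The constants `c` and `d` depend on
the family of patterns. -/
def ClosedForm (s : F) (U : ℕ → F) (j : ℕ) (c d β A₀ A₁ B₀ B₁ : F) : Prop :=
  A₀ = U (j + 1) / (s * U (j + 2)) ∧ A₁ = c / U (j + 2) ^ 2 ∧
    B₀ = s ^ 2 * (∑ i ∈ Finset.Icc 1 j, U i ^ 2 - d) / U (j + 2) ^ 2 ∧
    B₁ = β / U (j + 2) ^ 2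

theorem ClosedForm.succ {s : F} {U : ℕ → F} (hs : s ≠ 0) (hU : ∀ n, U n ≠ 0)
    (hU₁ : ∀ n, s * U (n + 2) = U (n + 1) - s * U n)
    (hU₂ : ∀ n, U n * U (n + 2) = U (n + 1) ^ 2 - 1)
    {j : ℕ} {c d β a₀ a₁ b₀ b₁ A₀ A₁ B₀ B₁ : F} (h : ClosedForm s U j c d β a₀ a₁ b₀ b₁)
    (hr : Recurrence (s ^ 2) a₀ a₁ b₀ b₁ a₀ a₁ A₀ A₁ B₀ B₁) :
    ClosedForm s U (j + 1) c d (β + 2 * c * s ^ 3 *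
      (∑ i ∈ Finset.Icc 1 (j + 2), U i ^ 2 - 1 - d) / (U (j + 2) * U (j + 3)))
      A₀ A₁ B₀ B₁ := by
  obtain ⟨rfl, rfl, rfl, rfl⟩ := h
  have := hr.step hs (hU _) (hU (j + 3)) (hU₁ (j + 1)) (hU₂ (j + 1))
  rw [ClosedForm, Finset.sum_Icc_succ_top (b := j + 1) (by omega),
    Finset.sum_Icc_succ_top (b := j) (by omega)]
  exact this

end Field

theorem sqrtX_ne_zero : sqrtX ≠ 0 := HahnSeries.single_ne_zero one_ne_zero

theorem ofPowerSeries_X_eq : HahnSeries.ofPowerSeries ℚ ℚ X = sqrtX ^ 2 := by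
  rw [HahnSeries.ofPowerSeries_X, sqrtX, HahnSeries.single_pow]
  norm_num

theorem two_ne_zero_xSeries : (2 : XSeries) ≠ 0 := by
  have h2 : (2 : PowerSeries ℚ) ≠ 0 := fun h => by
    have := congrArg constantCoeff h
    rw [map_ofNat, map_zero] at this
    exact two_ne_zero this
  have h := (map_ne_zero_iff (HahnSeries.ofPowerSeries ℚ ℚ)
    HahnSeries.ofPowerSeries_injective).2 h2
  rwa [map_ofNat] at h

theorem chebU_zero : chebU 0 = 1 := by simp [chebU]

theorem chebU_one : chebU 1 = sqrtX⁻¹ := by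
  have := sqrtX_ne_zero
  have h2 := two_ne_zero_xSeries
  simp only [chebU, Nat.cast_one, Polynomial.Chebyshev.U_one]
  simp
  field_simp

theorem sqrtX_mul_chebU_add_two (n : ℕ) :
    sqrtX * chebU (n + 2) = chebU (n + 1) - sqrtX * chebU n := by
  have := sqrtX_ne_zero
  have h2 := two_ne_zero_xSeries
  simp only [chebU, Nat.cast_add, Nat.cast_one, Nat.cast_ofNat,
    Polynomial.Chebyshev.U_add_two, Polynomial.eval_sub, Polynomial.eval_mul, Polynomial.eval_X,
    Polynomial.eval_ofNat]
  field_simp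

theorem chebU_mul_chebU (n : ℕ) : chebU n * chebU (n + 2) = chebU (n + 1) ^ 2 - 1 := by
  have hs := sqrtX_ne_zero
  have h : sqrtX * (chebU n * chebU (n + 2)) = sqrtX * (chebU (n + 1) ^ 2 - 1) := by
    induction n with
    | zero =>
      have h0 := sqrtX_mul_chebU_add_two 0
      rw [zero_add, zero_add, chebU_zero, chebU_one] at *
      linear_combination h0 - (sqrtX⁻¹) * inv_mul_cancel₀ hs
    | succ n ih =>
      have h0 := sqrtX_mul_chebU_add_two n
      have h1 := sqrtX_mul_chebU_add_two (n + 1)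
      linear_combination ih + chebU (n + 1) * h1 - chebU (n + 2) * h0
  exact mul_left_cancel₀ hs h

/-- The product `x ^ (n / 2) U_n(t)` is a power series with constant coefficient `1`. -/
theorem exists_sqrtX_pow_mul_chebU_eq (n : ℕ) : ∃ P Q : PowerSeries ℚ,
    constantCoeff P = 1 ∧ constantCoeff Q = 1 ∧
    sqrtX ^ n * chebU n = HahnSeries.ofPowerSeries ℚ ℚ P ∧
    sqrtX ^ (n + 1) * chebU (n + 1) = HahnSeries.ofPowerSeries ℚ ℚ Q := by
  induction n with
  | zero =>
    refine ⟨1, 1, by simp, by simp, by simp [chebU_zero], ?_⟩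
    rw [zero_add, chebU_one, pow_one, mul_inv_cancel₀ sqrtX_ne_zero, map_one]
  | succ n ih =>
    obtain ⟨P, Q, hP, hQ, h1, h2⟩ := ih
    refine ⟨Q, Q - X * P, hQ, by simp [hQ], h2, ?_⟩
    rw [map_sub, map_mul, ← h1, ← h2, ofPowerSeries_X_eq]
    linear_combination sqrtX ^ (n + 1) * sqrtX_mul_chebU_add_two n

theorem chebU_ne_zero (n : ℕ) : chebU n ≠ 0 := by
  intro h
  obtain ⟨P, -, hP, -, h1, -⟩ := exists_sqrtX_pow_mul_chebU_eq n
  rw [h, mul_zero, eq_comm, map_eq_zero_iff _ HahnSeries.ofPowerSeries_injective] at h1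
  rw [h1] at hP
  simp at hP

/-- The image of a power series in the field of Hahn series. -/
noncomputable abbrev toX : PowerSeries ℚ →+* XSeries := HahnSeries.ofPowerSeries ℚ ℚ

theorem closedForm_lt (j : ℕ) :
    ClosedForm sqrtX chebU j (1 / (sqrtX ^ 2 * chebU 2)) 0
      (1 / chebU 2 * (1 + ∑ i ∈ Finset.Icc 2 (j + 1), 2 * sqrtX / (chebU i * chebU (i + 1)) *
        ((∑ l ∈ Finset.Icc 1 i, chebU l ^ 2) - 1)))
      (toX (avSeries (occ LT.lt j) 0)) (toX (avSeries (occ LT.lt j) 1))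
      (toX (onceSeries (occ LT.lt j) 0)) (toX (onceSeries (occ LT.lt j) 1)) := by
  induction j with
  | zero =>
    have h := recurrence_occ_lt_zero.map toX
    simp only [toX, ofPowerSeries_X_eq, map_one, map_zero, map_sub] at h
    have hsu : sqrtX ^ 2 * chebU 2 = 1 - sqrtX ^ 2 := by
      have h0 := sqrtX_mul_chebU_add_two 0
      rw [zero_add, zero_add, chebU_zero, chebU_one] at h0
      linear_combination sqrtX * h0 + mul_inv_cancel₀ sqrtX_ne_zero
    obtain ⟨h1, h2, h3, h4⟩ := h.base_lt sqrtX_ne_zero (chebU_ne_zero 2) hsu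
    refine ⟨?_, h2, ?_, ?_⟩
    · rw [zero_add, zero_add, chebU_one]
      exact h1
    · rw [h3]
      simp
    · simpa using h4
  | succ j ih =>
    have h := (recurrence_occ_succ lt_strictMono_iff j (by omega) fun l => by
      rcases j with _ | j
      · exact occ_lt_one_eq_zero_of_occ_le_one
      · exact occ_eq_zero_of_occ_le_one).map toX
    rw [show toX X = sqrtX ^ 2 from ofPowerSeries_X_eq] at h
    have h' := ih.succ sqrtX_ne_zero chebU_ne_zero sqrtX_mul_chebU_add_two chebU_mul_chebU h
    refine ⟨h'.1, h'.2.1, h'.2.2.1, h'.2.2.2.trans ?_⟩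
    congr 1
    rw [Finset.sum_Icc_succ_top (a := 2) (b := j + 1) (by omega)]
    have hs := sqrtX_ne_zero
    have h2 := chebU_ne_zero 2
    have h3 : 2 * (1 / (sqrtX ^ 2 * chebU 2)) * sqrtX ^ 3 = 2 * sqrtX / chebU 2 := by
      field_simp
    rw [h3]
    ring

theorem closedForm_gt (j : ℕ) :
    ClosedForm sqrtX chebU (j + 1) 1 1
      (2 * sqrtX ^ 3 * (chebU 2 ^ 2 / chebU 3 + ∑ i ∈ Finset.Icc 3 (j + 2),
        1 / (chebU i * chebU (i + 1)) * ((∑ l ∈ Finset.Icc 1 i, chebU l ^ 2) - 2)))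
      (toX (avSeries (occ GT.gt (j + 1)) 0)) (toX (avSeries (occ GT.gt (j + 1)) 1))
      (toX (onceSeries (occ GT.gt (j + 1)) 0)) (toX (onceSeries (occ GT.gt (j + 1)) 1)) := by
  induction j with
  | zero =>
    have h := recurrence_occ_gt_one
    rw [avSeries_desc_one, onceSeries_desc_zero, onceSeries_desc_one] at h
    have h := h.map toX
    have hD := congrArg toX avSeries_desc_zero
    simp only [toX, ofPowerSeries_X_eq, map_one, map_zero, map_sub, map_mul, map_pow,
      map_add] at h hD
    have h0 := sqrtX_mul_chebU_add_two 0
    have h1 := sqrtX_mul_chebU_add_two 1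
    rw [zero_add, zero_add, chebU_zero, chebU_one] at h0
    rw [chebU_one, mul_inv_cancel₀ sqrtX_ne_zero] at h1
    have hsu : sqrtX ^ 2 * chebU 2 = 1 - sqrtX ^ 2 := by
      linear_combination sqrtX * h0 + mul_inv_cancel₀ sqrtX_ne_zero
    obtain ⟨h1, h2, h3, h4⟩ := h.base_gt sqrtX_ne_zero (chebU_ne_zero 2) (chebU_ne_zero 3) hsu h1 hD
    refine ⟨h1, h2, ?_, ?_⟩
    · simpa [chebU_one] using h3
    · simpa using h4
  | succ j ih =>
    have h := (recurrence_occ_succ gt_strictMono_iff (j + 1) (by omega) fun l =>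
      occ_eq_zero_of_occ_le_one).map toX
    rw [show toX X = sqrtX ^ 2 from ofPowerSeries_X_eq] at h
    have h' := ih.succ sqrtX_ne_zero chebU_ne_zero sqrtX_mul_chebU_add_two chebU_mul_chebU h
    refine ⟨h'.1, h'.2.1, h'.2.2.1, h'.2.2.2.trans ?_⟩
    congr 1
    rw [Finset.sum_Icc_succ_top (a := 3) (b := j + 2) (by omega)]
    ring

end OneThreeTwoOnce

theorem mainTheorem12 :
    (∀ k : ℕ, 2 ≤ k →
      HahnSeries.ofPowerSeries ℚ ℚ (GeneralizedPattern.Phi (GeneralizedPattern.oneTwo k)) =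
        1 / (chebU 2 * chebU k ^ 2) *
          (1 + ∑ i ∈ Finset.Icc 2 (k - 1),
            2 * sqrtX / (chebU i * chebU (i + 1)) *
              ((∑ j ∈ Finset.Icc 1 i, chebU j ^ 2) - 1))) ∧
    (∀ k : ℕ, 3 ≤ k →
      HahnSeries.ofPowerSeries ℚ ℚ (GeneralizedPattern.Phi (GeneralizedPattern.twoOne k)) =
        1 / (4 * (1 / (2 * sqrtX)) ^ 3 * chebU k ^ 2) *
          (chebU 2 ^ 2 / chebU 3 + ∑ i ∈ Finset.Icc 3 (k - 1),
            1 / (chebU i * chebU (i + 1)) *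
              ((∑ j ∈ Finset.Icc 1 i, chebU j ^ 2) - 2))) := by
  constructor
  · intro k hk
    obtain ⟨j, rfl⟩ := Nat.exists_eq_add_of_le' hk
    rw [OneThreeTwoOnce.phi_eq_onceSeries _ (OneThreeTwoOnce.occ LT.lt j)
      OneThreeTwoOnce.containedOnce_oneTwo_iff]
    rw [(OneThreeTwoOnce.closedForm_lt j).2.2.2]
    rw [show j + 2 - 1 = j + 1 from rfl, div_mul_eq_mul_div, div_mul_eq_mul_div, one_mul,
      div_div]
  · intro k hk
    obtain ⟨j, rfl⟩ := Nat.exists_eq_add_of_le' hk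
    rw [OneThreeTwoOnce.phi_eq_onceSeries _ (OneThreeTwoOnce.occ GT.gt (j + 1))
      OneThreeTwoOnce.containedOnce_twoOne_iff]
    rw [(OneThreeTwoOnce.closedForm_gt j).2.2.2]
    have hs := OneThreeTwoOnce.sqrtX_ne_zero
    rw [show j + 3 - 1 = j + 2 from rfl, show j + 1 + 2 = j + 3 from rfl]
    have h4 : 1 / (4 * (1 / (2 * sqrtX)) ^ 3 * chebU (j + 3) ^ 2) =
        2 * sqrtX ^ 3 / chebU (j + 3) ^ 2 := by
      have := OneThreeTwoOnce.chebU_ne_zero (j + 3)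
      have h2 := OneThreeTwoOnce.two_ne_zero_xSeries
      have h4 : (4 : XSeries) = 2 * 2 := by norm_num
      rw [h4]
      field_simp
    rw [h4, div_mul_eq_mul_div]
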